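/- **Market.** In round $t=1,\dots,T$ a platform observes a feature $x_t\in\mathbb R^d$ and the realized supply curve $P=\alpha_0+\alpha_1Q+\epsilon_{St}$, then sets a service fee $a_t\ge 0$, and then observes the equilibrium quantity and price $$Q_t=\frac{f(x_t)+\epsilon_{Dt}-\alpha_0-\epsilon_{St}-a_t}{\alpha_1-\beta},\qquad P_t=\alpha_0+\epsilon_{St}+\alpha_1Q_t+a_t ,$$ that is, the point where the supply price plus the fee equals the (truthful) demand price $\beta Q+f(x_t)+\epsilon_{Dt}$. Here $\alpha_1\ge0>\beta$, the $x_t$ are i.i.d. with law $\nu$, $\epsilon_{St}\sim\mathcal N(0,\sigma_S^2)$ and $\epsilon_{Dt}\sim\mathcal N(0,\sigma_D^2)$ are i.i.d. over $t$, and the three sequences are independent. Quantities are not truncated at $0$. **Algorithms and regret.** A (possibly randomized) algorithm chooses $a_t$ as a measurable function of a random seed independent of the market, of the observations $(\alpha_0+\epsilon_{S\tau},x_\tau,P_\tau,Q_\tau)_{\tau<t}$, of $\alpha_0+\epsilon_{St}$ and of $x_t$. Let $r_t(a)=\mathbb E_{\epsilon_{Dt}}[a\,Q_t(a)]$ be the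 expected revenue of the fee $a$ given $x_t$ and $\epsilon_{St}$, where $Q_t(a)$ is the equilibrium quantity at the fee $a$, and let $a_t^*=\operatorname{argmax}_{a\ge0}r_t(a)$. The expected regret is $\mathrm{Regret}(T)=\sum_{t=1}^T\mathbb E[r_t(a_t^*)-r_t(a_t)]\in[0,\infty]$. **Theorem.** Let $\alpha_1\ge 0$, and let $[b_-,b_+]$ with $b_-<b_+$ and $b_+>\alpha_0$, $[\beta_-,\beta_+]\subset(-\infty,0)$ with $\beta_-<\beta_+$, and $[s_-,s_+]\subset(0,\infty)$ with $s_-<s_+$ be given. There is a constant $c>0$, depending only on $\alpha_0,\alpha_1$ and these three intervals, such that the following holds for all $T\ge1$, all $\sigma_S>0$, all $d$, every law $\nu$ on $\mathbb R^d$, every class $\mathcal F$ of functions $\mathbb R^d\to\mathbb R$ that contains the constant functions with values in $[b_-,b_+]$, and every algorithm (which may depend on all of the above): there are $f\in\mathcal F$, $\beta\in[\beta_-,\beta_+]$ and $\sigma_D\in[s_-,s_+]$ for which $$\mathrm{Regret}(T)\ \ge\ c\,\min\Big\{\sqrt T,\ \frac{\log T}{\sigma_S^2\,\big(1+\max\{0,\log(1/\sigma_S)\}\big)}\Big\}.$$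 -/

import Mathlib

open MeasureTheory ProbabilityTheory
open scoped NNReal ENNReal

noncomputable section

/-- A market with `d`-dimensional features: supply curve `P = α₀ + α₁ Q + ε_S`, demand curve
`P = β Q + f x + ε_D`, with independent noises `ε_S ∼ N(0, σS²)` and `ε_D ∼ N(0, σD²)`, and
features drawn from the law `ν`. -/
structure Market (d : ℕ) where
  α₀ : ℝ
  α₁ : ℝ
  β : ℝ
  f : (Fin d → ℝ) → ℝ
  ν : Measure (Fin d → ℝ)
  σS : ℝ
  σD : ℝ

/-- The law `N(0, σ²)`. -/
def centeredGaussian (σ : ℝ) : Measure ℝ := gaussianReal 0 (Real.toNNReal (σ ^ 2))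

instance (σ : ℝ) : IsProbabilityMeasure (centeredGaussian σ) := by
  unfold centeredGaussian; infer_instance

/-- What the platform has observed once a round is over: the intercept `s = α₀ + ε_S` of the
realized supply curve, the feature vector, and the equilibrium price and quantity. -/
structure Observation (d : ℕ) where
  supply : ℝ
  feature : Fin d → ℝ
  price : ℝ
  quantity : ℝ

/-- The measurable structure that makes an observation the tuple of its four entries. -/
instance (d : ℕ) : MeasurableSpace (Observation d) :=
  MeasurableSpace.comap
    (fun o : Observation d => (o.supply, o.feature, o.price, o.quantity)) inferInstance

/-- A (possibly randomized) pricing algorithm. In round `t = 0, 1, 2, …` it sets a nonnegative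
service fee on the basis of its internal random seed in `S`, the observations of the `t` rounds
completed so far, the realized supply intercept of the current round and the current feature. -/
structure PricingPolicy (S : Type*) [MeasurableSpace S] (d : ℕ) where
  fee : (t : ℕ) → S × (Fin t → Observation d) × ℝ × (Fin d → ℝ) → ℝ≥0
  measurable_fee : ∀ t, Measurable (fee t)

namespace Market

variable {d : ℕ} (M : Market d)

/-- Price asked by the sellers for the quantity `q`, if the supply intercept is `s`. -/
def supplyPrice (s q : ℝ) : ℝ := s + M.α₁ * q

/-- Price the buyer is willing to pay for the quantity `q` (truthful demand curve). -/
def demandPrice (x : Fin d → ℝ) (eD q : ℝ) : ℝ := M.β * q + M.f x + eD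

/-- Equilibrium quantity at the service fee `a`. -/
def quantity (x : Fin d → ℝ) (s eD a : ℝ) : ℝ := (M.f x + eD - s - a) / (M.α₁ - M.β)

/-- Equilibrium price at the service fee `a`. -/
def price (x : Fin d → ℝ) (s eD a : ℝ) : ℝ := M.supplyPrice s (M.quantity x s eD a) + a

/-- The equilibrium quantity is the only one at which supply price plus fee is the demand price. -/
theorem equilibrium_iff (h : M.β < M.α₁) (x : Fin d → ℝ) (s eD a q : ℝ) :
    M.supplyPrice s q + a = M.demandPrice x eD q ↔ q = M.quantity x s eD a := by
  have h' : M.α₁ - M.β ≠ 0 := by linarith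
  unfold supplyPrice demandPrice quantity
  rw [eq_div_iff h']
  constructor <;> intro H <;> linarith

/-- Expected revenue of the fee `a`, over the demand noise, given the feature `x` and the supply
intercept `s`. -/
def expectedRevenue (x : Fin d → ℝ) (s a : ℝ) : ℝ :=
  ∫ eD, a * M.quantity x s eD a ∂(centeredGaussian M.σD)

/-- The clairvoyant fee: the maximizer of the expected revenue over all fees `a ≥ 0`, see
`isMaxOn_optimalFee`. -/
def optimalFee (x : Fin d → ℝ) (s : ℝ) : ℝ := max 0 ((M.f x - s) / 2)

theorem expectedRevenue_eq (x : Fin d → ℝ) (s a : ℝ) :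
    M.expectedRevenue x s a = a * (M.f x - s - a) / (M.α₁ - M.β) := by
  have hi : Integrable (fun e : ℝ => e) (centeredGaussian M.σD) :=
    (memLp_id_gaussianReal 1).integrable le_rfl
  have h0 : ∫ e, e ∂(centeredGaussian M.σD) = 0 := integral_id_gaussianReal
  have hfun : (fun eD : ℝ => a * M.quantity x s eD a) =
      fun eD => a * (M.f x - s - a) / (M.α₁ - M.β) + a / (M.α₁ - M.β) * eD := by
    funext eD
    unfold quantity
    ring
  unfold expectedRevenue
  rw [hfun, integral_add (integrable_const _) (hi.const_mul _), integral_const_mul, h0]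
  simp

theorem isMaxOn_optimalFee (h : M.β < M.α₁) (x : Fin d → ℝ) (s : ℝ) :
    M.optimalFee x s ∈ Set.Ici 0 ∧
      IsMaxOn (M.expectedRevenue x s) (Set.Ici 0) (M.optimalFee x s) := by
  refine ⟨le_max_left 0 ((M.f x - s) / 2), fun a ha => ?_⟩
  have ha' : 0 ≤ a := ha
  have hpos : 0 < M.α₁ - M.β := by linarith
  change M.expectedRevenue x s a ≤ M.expectedRevenue x s (M.optimalFee x s)
  rw [expectedRevenue_eq, expectedRevenue_eq]
  apply div_le_div_of_nonneg_right _ hpos.le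
  unfold optimalFee
  rcases le_total 0 ((M.f x - s) / 2) with h2 | h2
  · rw [max_eq_right h2]
    nlinarith [sq_nonneg (a - (M.f x - s) / 2)]
  · rw [max_eq_left h2]
    nlinarith

/-- Expected loss of revenue in one round caused by the fee `a`, given `x` and `s`. -/
def revenueGap (x : Fin d → ℝ) (s a : ℝ) : ℝ :=
  M.expectedRevenue x s (M.optimalFee x s) - M.expectedRevenue x s a

/-- The expected loss of a nonnegative fee is nonnegative. -/
theorem revenueGap_nonneg (h : M.β < M.α₁) (x : Fin d → ℝ) (s a : ℝ) (ha : 0 ≤ a) :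
    0 ≤ M.revenueGap x s a :=
  sub_nonneg.2 ((M.isMaxOn_optimalFee h x s).2 ha)

/-- The law of the triple (feature, supply noise, demand noise) of one round. -/
def roundLaw : Measure ((Fin d → ℝ) × ℝ × ℝ) :=
  M.ν.prod ((centeredGaussian M.σS).prod (centeredGaussian M.σD))

variable {S : Type*} [MeasurableSpace S]

/-- The observations of the first `t` rounds, when the algorithm `π` runs with the random seed `u`
and `w i` is the triple (feature, supply noise, demand noise) of round `i`. -/
def history (π : PricingPolicy S d) (u : S) :
    (t : ℕ) → (Fin t → (Fin d → ℝ) × ℝ × ℝ) → (Fin t → Observation d)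
  | 0, _ => Fin.elim0
  | t + 1, w =>
    let past : Fin t → Observation d := history π u t (Fin.init w)
    let x : Fin d → ℝ := (w (Fin.last t)).1
    let s : ℝ := M.α₀ + (w (Fin.last t)).2.1
    let eD : ℝ := (w (Fin.last t)).2.2
    let a : ℝ := π.fee t (u, past, s, x)
    Fin.snoc (α := fun _ => Observation d) past ⟨s, x, M.price x s eD a, M.quantity x s eD a⟩

/-- Expected regret of round `t`: seed, completed rounds, current feature and current supply noise
are independent, and the expectation over the current demand noise is inside `revenueGap`. -/
def roundRegret (ρ : Measure S) (π : PricingPolicy S d) (t : ℕ) : ℝ≥0∞ :=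
  ∫⁻ u, ∫⁻ w, ∫⁻ x, ∫⁻ eS,
      ENNReal.ofReal (M.revenueGap x (M.α₀ + eS)
        (π.fee t (u, M.history π u t w, M.α₀ + eS, x)))
    ∂(centeredGaussian M.σS) ∂M.ν ∂(Measure.pi fun _ : Fin t => M.roundLaw) ∂ρ

/-- Expected regret over `T` rounds of the algorithm `π` with seed law `ρ`. -/
def regret (ρ : Measure S) (π : PricingPolicy S d) (T : ℕ) : ℝ≥0∞ :=
  ∑ t ∈ Finset.range T, M.roundRegret ρ π t

end Market

end

/-!
The mean quantity is `θ₀ - θ₁ p`, where `p = ε_S + a` is the supply noise plus the fee, and without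
supply noise the revenue is maximal at `p*(θ) = θ₀ / (2 θ₁)`. Take a curve of markets with
`θ₀ ^ 2 ∝ θ₁`, parametrized by `τ ∝ θ₀`: along it the derivative of the mean quantity in `τ`
vanishes at `p*(θ)`. So an algorithm learns about `τ` only from the rounds in which it charges a
suboptimal fee, and from the variation of `p` that the supply noise causes by itself. The
information gained in `t` rounds is at most of the order `Regret(t) + σS² t`.

If the regret stays below `√T` for all `τ`, two parameters at distance about
`(√T + σS² t) ^ (-1/2)` thus cannot be told apart in round `t`, and since their optimal fees differ
by about as much, a regret of order `1 / (√T + σS² t)` in round `t` is unavoidable for one of them.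
Averaged over `τ` and summed over `t`, this gives `log (1 + σS² √T) / σS²`.
-/

/-! ### Gaussian laws -/

/-- The square root of the likelihood ratio between `N(μ', v)` and `N(μ, v)`. Its integral under
`N(μ, v)` is the Hellinger affinity of the two laws. -/
noncomputable def gaussianRootRatio (μ μ' : ℝ) (v : ℝ≥0) (q : ℝ) : ℝ≥0∞ :=
  ENNReal.ofReal (Real.exp ((μ' - μ) * (q - μ) / (2 * v) - (μ' - μ) ^ 2 / (4 * v)))

theorem measurable_gaussianRootRatio {Ω : Type*} [MeasurableSpace Ω] {f g h : Ω → ℝ}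
    (hf : Measurable f) (hg : Measurable g) (v : ℝ≥0) (hh : Measurable h) :
    Measurable fun ω => gaussianRootRatio (f ω) (g ω) v (h ω) := by
  unfold gaussianRootRatio
  fun_prop

theorem gaussianReal_eq_withDensity_rootRatio_sq (μ μ' : ℝ) {v : ℝ≥0} (hv : v ≠ 0) :
    gaussianReal μ' v = (gaussianReal μ v).withDensity fun q => gaussianRootRatio μ μ' v q ^ 2 := by
  have hv' : (v : ℝ) ≠ 0 := by exact_mod_cast hv
  have hratio : Measurable fun q => gaussianRootRatio μ μ' v q :=
    measurable_gaussianRootRatio measurable_const measurable_const v measurable_id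
  rw [gaussianReal_of_var_ne_zero _ hv, gaussianReal_of_var_ne_zero _ hv,
    ← withDensity_mul _ (measurable_gaussianPDF μ v) (hratio.pow_const 2)]
  congr 1 with q
  rw [Pi.mul_apply, gaussianPDF, gaussianPDF, gaussianRootRatio,
    ← ENNReal.ofReal_pow (Real.exp_pos _).le, ← ENNReal.ofReal_mul (gaussianPDFReal_nonneg _ _ _),
    gaussianPDFReal, gaussianPDFReal, ← Real.exp_nat_mul, mul_assoc _ (Real.exp _) (Real.exp _),
    ← Real.exp_add]
  congr 3
  push_cast
  field_simp
  ring

theorem lintegral_gaussianRootRatio (μ μ' : ℝ) {v : ℝ≥0} (hv : v ≠ 0) :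
    ∫⁻ q, gaussianRootRatio μ μ' v q ∂gaussianReal μ v =
      ENNReal.ofReal (Real.exp (-((μ' - μ) ^ 2 / (8 * v)))) := by
  have hv' : (v : ℝ) ≠ 0 := by exact_mod_cast hv
  set r : ℝ := (μ' - μ) / (2 * v)
  have hratio : ∀ q, gaussianRootRatio μ μ' v q = ENNReal.ofReal
      (Real.exp (-(r * μ) - (μ' - μ) ^ 2 / (4 * v)) * Real.exp (r * q)) := fun q => by
    rw [gaussianRootRatio, ← Real.exp_add]
    congr 2
    ring
  have hmgf : ∫ q, Real.exp (r * q) ∂gaussianReal μ v = Real.exp (μ * r + v * r ^ 2 / 2) :=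
    congrFun mgf_id_gaussianReal r
  simp_rw [hratio]
  rw [← ofReal_integral_eq_lintegral_ofReal ((integrable_exp_mul_gaussianReal r).const_mul _)
    (Filter.Eventually.of_forall fun q => by positivity), integral_const_mul, hmgf, ← Real.exp_add]
  congr 2
  simp only [r]
  field_simp
  ring

theorem one_le_lintegral_gaussianRootRatio_add (μ μ' : ℝ) {v : ℝ≥0} (hv : v ≠ 0) :
    1 ≤ ∫⁻ q, gaussianRootRatio μ μ' v q ∂gaussianReal μ v
      + ENNReal.ofReal ((μ' - μ) ^ 2 / (8 * v)) := by
  rw [lintegral_gaussianRootRatio μ μ' hv, ← ENNReal.ofReal_add (by positivity) (by positivity),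
    ENNReal.one_le_ofReal]
  linarith [Real.add_one_le_exp (-((μ' - μ) ^ 2 / (8 * v)))]

theorem lintegral_sq_centeredGaussian (σ : ℝ) :
    ∫⁻ e, ENNReal.ofReal (e ^ 2) ∂centeredGaussian σ = ENNReal.ofReal (σ ^ 2) := by
  have hmean : ∫ e, e ∂centeredGaussian σ = 0 := integral_id_gaussianReal
  have hvar := evariance_eq_lintegral_ofReal (X := id) (μ := centeredGaussian σ)
  have hLp : MemLp (id : ℝ → ℝ) 2 (centeredGaussian σ) := memLp_id_gaussianReal 2
  rw [← ofReal_variance hLp] at hvar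
  simp only [id, hmean, sub_zero] at hvar
  rw [← hvar, centeredGaussian, variance_id_gaussianReal, Real.coe_toNNReal _ (sq_nonneg σ)]

theorem half_le_centeredGaussian_Iic (σ : ℝ) : 2⁻¹ ≤ centeredGaussian σ (Set.Iic 0) := by
  have hsymm : centeredGaussian σ (Set.Ici 0) = centeredGaussian σ (Set.Iic 0) := by
    have hneg : (centeredGaussian σ).map (fun x => -x) = centeredGaussian σ := by
      rw [centeredGaussian, gaussianReal_map_neg, neg_zero]
    conv_rhs => rw [← hneg, Measure.map_apply measurable_neg measurableSet_Iic]
    simp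
  have hcover : 1 ≤ centeredGaussian σ (Set.Iic 0) + centeredGaussian σ (Set.Ici 0) := by
    rw [← measure_univ (μ := centeredGaussian σ), ← Set.Iic_union_Ici (a := (0 : ℝ))]
    exact measure_union_le _ _
  rw [hsymm, ← mul_two] at hcover
  rwa [ENNReal.inv_le_iff_le_mul (by simp) (by simp), mul_comm]

/-! ### Affinity and the sum of two losses -/

theorem inv_two_mul_inv_two : (2⁻¹ : ℝ≥0∞) * 2⁻¹ = 4⁻¹ := by
  rw [← ENNReal.mul_inv (by simp) (by simp)]
  norm_num

theorem le_four_mul_of_le_add {x y : ℝ≥0∞} (hx : x ≠ ∞) (h : x ≤ y + 2⁻¹ * x + 4⁻¹ * x) :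
    x ≤ 4 * y := by
  have hreal (x y : ℝ≥0) (h : x ≤ y + 2⁻¹ * x + 4⁻¹ * x) : x ≤ 4 * y := by
    rw [← NNReal.coe_le_coe] at h ⊢
    push_cast at h ⊢
    linarith
  lift x to ℝ≥0 using hx
  induction y with
  | top => simp
  | coe y =>
    rw [show (2⁻¹ : ℝ≥0∞) = ((2⁻¹ : ℝ≥0) : ℝ≥0∞) by simp,
      show (4⁻¹ : ℝ≥0∞) = ((4⁻¹ : ℝ≥0) : ℝ≥0∞) by simp] at h
    exact_mod_cast hreal x y (by exact_mod_cast h)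

theorem mul_le_half_add_sq_mul (k j : ℝ≥0∞) : k * j ≤ 2⁻¹ * (j + k ^ 2 * j) := by
  have hk : k ≤ 2⁻¹ * (1 + k ^ 2) := by
    induction k with
    | top => simp
    | coe k =>
      rw [show (2⁻¹ : ℝ≥0∞) = ((2⁻¹ : ℝ≥0) : ℝ≥0∞) by simp]
      norm_cast
      rw [← NNReal.coe_le_coe]
      push_cast
      nlinarith [sq_nonneg ((k : ℝ) - 1)]
  calc k * j ≤ 2⁻¹ * (1 + k ^ 2) * j := by gcongr
    _ = 2⁻¹ * (j + k ^ 2 * j) := by ring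

theorem le_min_one_sq_add_quarter (k : ℝ≥0∞) : k ≤ min 1 (k ^ 2) + 4⁻¹ * (1 + k ^ 2) := by
  induction k with
  | top => simp
  | coe k =>
    rw [show (4⁻¹ : ℝ≥0∞) = ((4⁻¹ : ℝ≥0) : ℝ≥0∞) by simp]
    norm_cast
    rw [← NNReal.coe_le_coe]
    push_cast
    rcases min_cases (1 : ℝ) ((k : ℝ) ^ 2) with ⟨hmin, -⟩ | ⟨hmin, -⟩ <;> rw [hmin]
    · nlinarith [sq_nonneg ((k : ℝ) - 2)]
    · nlinarith [sq_nonneg (5 * (k : ℝ) - 2)]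

section ChangeOfMeasure

variable {Ω : Type*} [MeasurableSpace Ω] {P : Measure Ω} {K : Ω → ℝ≥0∞}

theorem lintegral_le_lintegral_mul_add {A J : Ω → ℝ≥0∞} (hK : Measurable K) (hA : Measurable A)
    (hJ : Measurable J) (hAJ : ∀ ω, 1 ≤ A ω + J ω) :
    ∫⁻ ω, K ω ∂P ≤
      ∫⁻ ω, K ω * A ω ∂P + 2⁻¹ * (∫⁻ ω, J ω ∂P + ∫⁻ ω, K ω ^ 2 * J ω ∂P) := by
  rw [← lintegral_add_left hJ, ← lintegral_const_mul _ (by fun_prop),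
    ← lintegral_add_left (by fun_prop)]
  refine lintegral_mono fun ω => ?_
  calc K ω = K ω * 1 := (mul_one _).symm
    _ ≤ K ω * (A ω + J ω) := by gcongr; exact hAJ ω
    _ = K ω * A ω + K ω * J ω := mul_add _ _ _
    _ ≤ K ω * A ω + 2⁻¹ * (J ω + K ω ^ 2 * J ω) :=
        add_le_add le_rfl (mul_le_half_add_sq_mul _ _)

/- `g` and `g'` are the losses under two laws whose likelihood ratio is `K ^ 2`: no decision makes
both small, so the two expected losses add up to at least `Δ` times the affinity, up to `Δ / 2`. -/
theorem mul_lintegral_le_of_le_add [IsProbabilityMeasure P] {g g' : Ω → ℝ≥0∞} {Δ : ℝ≥0∞}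
    (hK : Measurable K) (hg : Measurable g) (hg' : Measurable g') (hK2 : ∫⁻ ω, K ω ^ 2 ∂P = 1)
    (hΔ : ∀ ω, Δ ≤ g ω + g' ω) :
    Δ * ∫⁻ ω, K ω ∂P ≤ ∫⁻ ω, g ω ∂P + ∫⁻ ω, K ω ^ 2 * g' ω ∂P + 2⁻¹ * Δ := by
  have hpoint : ∀ ω, Δ * K ω ≤ g ω + K ω ^ 2 * g' ω + 4⁻¹ * Δ * (1 + K ω ^ 2) := fun ω =>
    calc Δ * K ω ≤ Δ * (min 1 (K ω ^ 2) + 4⁻¹ * (1 + K ω ^ 2)) := by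
          gcongr
          exact le_min_one_sq_add_quarter _
      _ = min 1 (K ω ^ 2) * Δ + 4⁻¹ * Δ * (1 + K ω ^ 2) := by ring
      _ ≤ min 1 (K ω ^ 2) * (g ω + g' ω) + 4⁻¹ * Δ * (1 + K ω ^ 2) := by
          gcongr
          exact hΔ ω
      _ ≤ 1 * g ω + K ω ^ 2 * g' ω + 4⁻¹ * Δ * (1 + K ω ^ 2) := by
          rw [mul_add]
          gcongr
          · exact min_le_left _ _
          · exact min_le_right _ _
      _ = g ω + K ω ^ 2 * g' ω + 4⁻¹ * Δ * (1 + K ω ^ 2) := by rw [one_mul]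
  have hquarter : (4⁻¹ : ℝ≥0∞) * 2 = 2⁻¹ := by
    rw [← inv_two_mul_inv_two, mul_assoc,
      ENNReal.inv_mul_cancel two_ne_zero ENNReal.ofNat_ne_top, mul_one]
  calc Δ * ∫⁻ ω, K ω ∂P = ∫⁻ ω, Δ * K ω ∂P := (lintegral_const_mul _ hK).symm
    _ ≤ ∫⁻ ω, g ω + K ω ^ 2 * g' ω + 4⁻¹ * Δ * (1 + K ω ^ 2) ∂P := lintegral_mono hpoint
    _ = ∫⁻ ω, g ω ∂P + ∫⁻ ω, K ω ^ 2 * g' ω ∂P + 4⁻¹ * Δ * (1 + 1) := by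
        rw [lintegral_add_left (by fun_prop), lintegral_add_left hg,
          lintegral_const_mul _ (by fun_prop), lintegral_add_left measurable_const, hK2,
          lintegral_const, measure_univ, mul_one]
    _ = ∫⁻ ω, g ω ∂P + ∫⁻ ω, K ω ^ 2 * g' ω ∂P + 2⁻¹ * Δ := by
        rw [one_add_one_eq_two, mul_right_comm, hquarter]

end ChangeOfMeasure

/-! ### The laws of contexts and records -/

section FinTuples

variable {α : Type*} [MeasurableSpace α] {n : ℕ}

theorem measurable_fin_snoc {Ω : Type*} [MeasurableSpace Ω] {f : Ω → Fin n → α} {g : Ω → α}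
    (hf : Measurable f) (hg : Measurable g) :
    Measurable fun ω => Fin.snoc (α := fun _ => α) (f ω) (g ω) := by
  refine measurable_pi_iff.2 (Fin.lastCases ?_ fun i => ?_)
  · simpa only [Fin.snoc_last] using hg
  · simpa only [Fin.snoc_castSucc, Function.comp_def] using (measurable_pi_apply i).comp hf

theorem lintegral_pi_fin_succ (μ : Measure α) [SigmaFinite μ] {G : (Fin n → α) → α → ℝ≥0∞}
    (hG : Measurable G.uncurry) :
    ∫⁻ w, G (Fin.init w) (w (Fin.last n)) ∂Measure.pi (fun _ : Fin (n + 1) => μ) =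
      ∫⁻ w, ∫⁻ y, G w y ∂μ ∂Measure.pi fun _ : Fin n => μ := by
  have hsplit := measurePreserving_piFinSuccAbove (fun _ : Fin (n + 1) => μ) (Fin.last n)
  have hGswap : Measurable fun p : α × (Fin n → α) => G p.2 p.1 := hG.comp measurable_swap
  rw [← lintegral_prod_symm' _ hGswap, ← hsplit.lintegral_comp hGswap]
  simp [MeasurableEquiv.piFinSuccAbove, Fin.insertNthEquiv]

end FinTuples

namespace Observation

variable {d : ℕ} {Ω : Type*} [MeasurableSpace Ω]

@[fun_prop]
theorem measurable_mk {s p q : Ω → ℝ} {x : Ω → Fin d → ℝ} (hs : Measurable s)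
    (hx : Measurable x) (hp : Measurable p) (hq : Measurable q) :
    Measurable fun ω => (⟨s ω, x ω, p ω, q ω⟩ : Observation d) :=
  measurable_comap_iff.2 (hs.prodMk (hx.prodMk (hp.prodMk hq)))

theorem measurable_entries :
    Measurable fun o : Observation d => (o.supply, o.feature, o.price, o.quantity) :=
  comap_measurable _

@[fun_prop]
theorem measurable_supply : Measurable (supply : Observation d → ℝ) :=
  measurable_entries.fst

@[fun_prop]
theorem measurable_feature : Measurable (feature : Observation d → Fin d → ℝ) :=
  measurable_entries.snd.fst

@[fun_prop]
theorem measurable_price : Measurable (price : Observation d → ℝ) :=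
  measurable_entries.snd.snd.fst

@[fun_prop]
theorem measurable_quantity : Measurable (quantity : Observation d → ℝ) :=
  measurable_entries.snd.snd.snd

end Observation

/-- What determines the law of a round's quantity: feature, supply intercept and fee. -/
abbrev Context (d : ℕ) : Type := (Fin d → ℝ) × ℝ × ℝ

/-- What a pricing policy knows when a round starts: its seed and the completed rounds. -/
abbrev Record (S : Type*) (d t : ℕ) : Type _ := S × (Fin t → Observation d)

/-- The record `r` prolonged by one round with observation `o`. -/
def Record.snoc {S : Type*} {d t : ℕ} (r : Record S d t) (o : Observation d) :
    Record S d (t + 1) :=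
  (r.1, Fin.snoc (α := fun _ => Observation d) r.2 o)

@[fun_prop]
theorem Record.measurable_snoc {S : Type*} [MeasurableSpace S] {d t : ℕ} :
    Measurable fun p : Record S d t × Observation d => p.1.snoc p.2 :=
  measurable_fst.fst.prodMk (measurable_fin_snoc measurable_fst.snd measurable_snd)

namespace Market

variable {d : ℕ} (M : Market d)

/-- The observation of a round with context `c` and equilibrium quantity `q`. -/
def observe (c : Context d) (q : ℝ) : Observation d :=
  ⟨c.2.1, c.1, M.supplyPrice c.2.1 q + c.2.2, q⟩

/-- The mean of the equilibrium quantity in a given context. -/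
noncomputable def meanQuantity (c : Context d) : ℝ := (M.f c.1 - c.2.1 - c.2.2) / (M.α₁ - M.β)

/-- The variance of the equilibrium quantity, the same in every context. -/
noncomputable def quantityVar : ℝ≥0 := Real.toNNReal ((M.σD / (M.α₁ - M.β)) ^ 2)

@[fun_prop]
theorem measurable_observe : Measurable fun p : Context d × ℝ => M.observe p.1 p.2 := by
  unfold observe supplyPrice
  fun_prop

theorem measurable_observe_left (c : Context d) : Measurable (M.observe c) := by
  unfold observe supplyPrice
  fun_prop

theorem map_quantity (c : Context d) :
    (centeredGaussian M.σD).map (fun eD => M.quantity c.1 c.2.1 eD c.2.2) =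
      gaussianReal (M.meanQuantity c) M.quantityVar := by
  have hquantity : (fun eD => M.quantity c.1 c.2.1 eD c.2.2) =
      (M.meanQuantity c + ·) ∘ ((M.α₁ - M.β)⁻¹ * ·) := by
    funext eD
    simp only [quantity, meanQuantity, Function.comp]
    ring
  rw [hquantity, ← Measure.map_map (by fun_prop) (by fun_prop), centeredGaussian,
    gaussianReal_map_const_mul, gaussianReal_map_const_add]
  congr 1
  · ring
  · apply NNReal.coe_injective
    simp only [quantityVar, NNReal.coe_mul, Real.coe_toNNReal _ (sq_nonneg _), NNReal.coe_mk]
    ring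

variable {M}

theorem measurable_meanQuantity (hf : Measurable M.f) : Measurable M.meanQuantity := by
  unfold meanQuantity
  fun_prop

theorem measurable_uncurry_quantity (hf : Measurable M.f) :
    Measurable fun p : Context d × ℝ => M.quantity p.1.1 p.1.2.1 p.2 p.1.2.2 := by
  unfold quantity
  fun_prop

/-- The law of the equilibrium quantity as a function of the context. -/
noncomputable def quantityKernel (hf : Measurable M.f) : Kernel (Context d) ℝ where
  toFun c := gaussianReal (M.meanQuantity c) M.quantityVar
  measurable' := measurable_gaussianReal.comp
    ((measurable_meanQuantity hf).prodMk measurable_const)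

instance (hf : Measurable M.f) : IsMarkovKernel (quantityKernel hf) :=
  ⟨fun c => inferInstanceAs (IsProbabilityMeasure (gaussianReal (M.meanQuantity c) M.quantityVar))⟩

theorem lintegral_quantityKernel (hf : Measurable M.f) (c : Context d) {g : ℝ → ℝ≥0∞}
    (hg : Measurable g) :
    ∫⁻ q, g q ∂quantityKernel hf c =
      ∫⁻ eD, g (M.quantity c.1 c.2.1 eD c.2.2) ∂centeredGaussian M.σD := by
  have hlaw : quantityKernel hf c =
      (centeredGaussian M.σD).map fun eD => M.quantity c.1 c.2.1 eD c.2.2 :=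
    (M.map_quantity c).symm
  rw [hlaw, lintegral_map hg (by unfold quantity; fun_prop)]

variable {S : Type*} [MeasurableSpace S] (π : PricingPolicy S d) (t : ℕ)

variable (M) in
/-- The context of a round that starts with the record `r`, has feature `z.1` and supply noise
`z.2`, and in which the policy `π` sets the fee. -/
def context (r : Record S d t) (z : (Fin d → ℝ) × ℝ) : Context d :=
  (z.1, M.α₀ + z.2, π.fee t (r.1, r.2, M.α₀ + z.2, z.1))

variable (M) in
/-- The record `r` prolonged by one round with feature `y.1`, supply noise `y.2.1`
and demand noise `y.2.2`. -/
noncomputable def nextRecord (r : Record S d t) (y : (Fin d → ℝ) × ℝ × ℝ) : Record S d (t + 1) :=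
  let c := M.context π t r (y.1, y.2.1)
  r.snoc (M.observe c (M.quantity c.1 c.2.1 y.2.2 c.2.2))

theorem measurable_context :
    Measurable fun p : Record S d t × (Fin d → ℝ) × ℝ => M.context π t p.1 p.2 := by
  have := π.measurable_fee t
  unfold context
  fun_prop

theorem measurable_nextRecord (hf : Measurable M.f) :
    Measurable fun p : Record S d t × (Fin d → ℝ) × ℝ × ℝ => M.nextRecord π t p.1 p.2 := by
  have hc : Measurable fun p : Record S d t × (Fin d → ℝ) × ℝ × ℝ =>
      M.context π t p.1 (p.2.1, p.2.2.1) :=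
    (measurable_context π t).comp
      (measurable_fst.prodMk (measurable_snd.fst.prodMk measurable_snd.snd.fst))
  have hq := (measurable_uncurry_quantity hf).comp (hc.prodMk measurable_snd.snd.snd)
  exact Record.measurable_snoc.comp
    (measurable_fst.prodMk (M.measurable_observe.comp (hc.prodMk hq)))

theorem history_succ (u : S) (w : Fin (t + 1) → (Fin d → ℝ) × ℝ × ℝ) :
    (u, M.history π u (t + 1) w) =
      M.nextRecord π t (u, M.history π u t (Fin.init w)) (w (Fin.last t)) := rfl

theorem measurable_history (hf : Measurable M.f) :
    Measurable fun p : S × (Fin t → (Fin d → ℝ) × ℝ × ℝ) => (p.1, M.history π p.1 t p.2) := by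
  induction t with
  | zero => exact measurable_fst.prodMk (measurable_pi_iff.2 fun i => i.elim0)
  | succ t ih =>
    have hinit : Measurable fun p : S × (Fin (t + 1) → (Fin d → ℝ) × ℝ × ℝ) =>
        (p.1, M.history π p.1 t (Fin.init p.2)) := by
      refine ih.comp (measurable_fst.prodMk (measurable_pi_iff.2 fun i => ?_))
      exact (measurable_pi_apply _).comp measurable_snd
    simp only [history_succ]
    exact (measurable_nextRecord π t hf).comp
      (hinit.prodMk ((measurable_pi_apply _).comp measurable_snd))

variable (M) in
/-- The law of the context of round `t` as a function of the record at its start. -/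
noncomputable def contextKernel : Kernel (Record S d t) (Context d) :=
  (Kernel.id ×ₖ Kernel.const _ (M.ν.prod (centeredGaussian M.σS))).map
    fun p => M.context π t p.1 p.2

variable (M) in
/-- The law of the record at the start of round `t` when the seed has law `ρ`. -/
noncomputable def recordLaw (ρ : Measure S) : Measure (Record S d t) :=
  (ρ.prod (Measure.pi fun _ : Fin t => M.roundLaw)).map fun p => (p.1, M.history π p.1 t p.2)

instance [IsProbabilityMeasure M.ν] : IsProbabilityMeasure M.roundLaw := by
  unfold roundLaw
  infer_instance

instance [IsProbabilityMeasure M.ν] : IsMarkovKernel (M.contextKernel π t) :=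
  Kernel.IsMarkovKernel.map _ (measurable_context π t)

theorem isProbabilityMeasure_recordLaw [IsProbabilityMeasure M.ν] (hf : Measurable M.f)
    (ρ : Measure S) [IsProbabilityMeasure ρ] : IsProbabilityMeasure (M.recordLaw π t ρ) :=
  Measure.isProbabilityMeasure_map (measurable_history π t hf).aemeasurable

theorem sq_sub_optimalFee_le_revenueGap (h : M.β < M.α₁) (x : Fin d → ℝ) (s : ℝ) {a : ℝ}
    (ha : 0 ≤ a) : (a - M.optimalFee x s) ^ 2 / (M.α₁ - M.β) ≤ M.revenueGap x s a := by
  rw [revenueGap, expectedRevenue_eq, expectedRevenue_eq, ← sub_div]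
  refine div_le_div_of_nonneg_right ?_ (sub_pos.2 h).le
  unfold optimalFee
  rcases le_total 0 ((M.f x - s) / 2) with hfee | hfee
  · rw [max_eq_right hfee]
    nlinarith
  · rw [max_eq_left hfee]
    nlinarith

theorem measurable_revenueGap (hf : Measurable M.f) :
    Measurable fun c : Context d => M.revenueGap c.1 c.2.1 c.2.2 := by
  simp only [revenueGap, expectedRevenue_eq, optimalFee]
  fun_prop

section Probability

variable [IsProbabilityMeasure M.ν] {π t}

theorem lintegral_contextKernel {g : Context d → ℝ≥0∞} (hg : Measurable g) (r : Record S d t) :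
    ∫⁻ c, g c ∂M.contextKernel π t r =
      ∫⁻ x, ∫⁻ eS, g (M.context π t r (x, eS)) ∂centeredGaussian M.σS ∂M.ν := by
  have hc := measurable_context (M := M) π t
  have hgc : Measurable fun p : Record S d t × (Fin d → ℝ) × ℝ => g (M.context π t p.1 p.2) :=
    hg.comp hc
  rw [contextKernel, Kernel.lintegral_map _ hc _ hg, Kernel.prod_apply, Kernel.id_apply,
    Kernel.const_apply, Measure.dirac_prod, lintegral_map hgc measurable_prodMk_left,
    lintegral_prod _ (by fun_prop)]

theorem lintegral_contextKernel_of_supply {g : ℝ → ℝ≥0∞} (hg : Measurable g)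
    (r : Record S d t) :
    ∫⁻ c, g (c.2.1 - M.α₀) ∂M.contextKernel π t r = ∫⁻ eS, g eS ∂centeredGaussian M.σS := by
  rw [lintegral_contextKernel (by fun_prop)]
  simp [context]

theorem lintegral_contextKernel_mono {g g' : Context d → ℝ≥0∞} (hg : Measurable g)
    (hg' : Measurable g') (hgg' : ∀ c : Context d, 0 ≤ c.2.2 → g c ≤ g' c) (r : Record S d t) :
    ∫⁻ c, g c ∂M.contextKernel π t r ≤ ∫⁻ c, g' c ∂M.contextKernel π t r := by
  rw [lintegral_contextKernel hg, lintegral_contextKernel hg']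
  exact lintegral_mono fun x => lintegral_mono fun eS => hgg' _ NNReal.zero_le_coe

theorem half_mul_le_lintegral_contextKernel {g : Context d → ℝ≥0∞} (hg : Measurable g)
    (r : Record S d t) {Δ : ℝ≥0∞} (hΔ : ∀ c : Context d, c.2.1 ≤ M.α₀ → 0 ≤ c.2.2 → Δ ≤ g c) :
    2⁻¹ * Δ ≤ ∫⁻ c, g c ∂M.contextKernel π t r := by
  have hnoise (x : Fin d → ℝ) :
      2⁻¹ * Δ ≤ ∫⁻ eS, g (M.context π t r (x, eS)) ∂centeredGaussian M.σS :=
    calc 2⁻¹ * Δ ≤ Δ * centeredGaussian M.σS (Set.Iic 0) := by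
          rw [mul_comm]
          gcongr
          exact half_le_centeredGaussian_Iic _
      _ = ∫⁻ _ in Set.Iic 0, Δ ∂centeredGaussian M.σS := (setLIntegral_const _ _).symm
      _ ≤ ∫⁻ eS in Set.Iic 0, g (M.context π t r (x, eS)) ∂centeredGaussian M.σS :=
          setLIntegral_mono' measurableSet_Iic fun eS heS =>
            hΔ _ (add_le_of_nonpos_right heS) NNReal.zero_le_coe
      _ ≤ _ := setLIntegral_le_lintegral _ _
  rw [lintegral_contextKernel hg]
  calc 2⁻¹ * Δ = ∫⁻ _, 2⁻¹ * Δ ∂M.ν := by rw [lintegral_const, measure_univ, mul_one]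
    _ ≤ _ := lintegral_mono hnoise

theorem lintegral_recordLaw (hf : Measurable M.f) (ρ : Measure S) [SFinite ρ]
    {g : Record S d t → ℝ≥0∞} (hg : Measurable g) :
    ∫⁻ r, g r ∂M.recordLaw π t ρ =
      ∫⁻ u, ∫⁻ w, g (u, M.history π u t w) ∂(Measure.pi fun _ : Fin t => M.roundLaw) ∂ρ := by
  have hh := measurable_history π t hf
  rw [recordLaw, lintegral_map hg hh]
  exact lintegral_prod _ (hg.comp hh).aemeasurable

theorem lintegral_nextRecord (hf : Measurable M.f) {g : Record S d (t + 1) → ℝ≥0∞}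
    (hg : Measurable g) (r : Record S d t) :
    ∫⁻ y, g (M.nextRecord π t r y) ∂M.roundLaw =
      ∫⁻ c, ∫⁻ q, g (r.snoc (M.observe c q)) ∂quantityKernel hf c ∂M.contextKernel π t r := by
  have hsnoc : Measurable fun p : Context d × ℝ => g (r.snoc (M.observe p.1 p.2)) :=
    hg.comp (Record.measurable_snoc.comp (measurable_const.prodMk M.measurable_observe))
  have hnext : Measurable fun y => g (M.nextRecord π t r y) :=
    hg.comp ((measurable_nextRecord π t hf).comp measurable_prodMk_left)
  have hquantity (c : Context d) : ∫⁻ q, g (r.snoc (M.observe c q)) ∂quantityKernel hf c =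
      ∫⁻ eD, g (r.snoc (M.observe c (M.quantity c.1 c.2.1 eD c.2.2))) ∂centeredGaussian M.σD :=
    lintegral_quantityKernel hf c (hsnoc.comp (measurable_prodMk_left (x := c)))
  rw [lintegral_contextKernel (hsnoc.lintegral_kernel_prod_right' (κ := quantityKernel hf)),
    roundLaw, lintegral_prod _ hnext.aemeasurable]
  simp_rw [hquantity]
  exact lintegral_congr fun x =>
    lintegral_prod _ (hnext.comp measurable_prodMk_left).aemeasurable

theorem measurable_lintegral_round (hf : Measurable M.f) {g : Record S d (t + 1) → ℝ≥0∞}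
    (hg : Measurable g) :
    Measurable fun r : Record S d t =>
      ∫⁻ c, ∫⁻ q, g (r.snoc (M.observe c q)) ∂quantityKernel hf c ∂M.contextKernel π t r := by
  simp_rw [← lintegral_nextRecord hf hg]
  exact (hg.comp (measurable_nextRecord π t hf)).lintegral_prod_right'

theorem lintegral_recordLaw_succ (hf : Measurable M.f) (ρ : Measure S) [SFinite ρ]
    {g : Record S d (t + 1) → ℝ≥0∞} (hg : Measurable g) :
    ∫⁻ r, g r ∂M.recordLaw π (t + 1) ρ =
      ∫⁻ r, ∫⁻ c, ∫⁻ q, g (r.snoc (M.observe c q))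
        ∂quantityKernel hf c ∂M.contextKernel π t r ∂M.recordLaw π t ρ := by
  rw [lintegral_recordLaw hf ρ hg, lintegral_recordLaw hf ρ (measurable_lintegral_round hf hg)]
  simp_rw [← lintegral_nextRecord hf hg, history_succ]
  refine lintegral_congr fun u => ?_
  have hu : Measurable fun w => (u, M.history π u t w) :=
    (measurable_history π t hf).comp measurable_prodMk_left
  exact lintegral_pi_fin_succ M.roundLaw
    (G := fun w y => g (M.nextRecord π t (u, M.history π u t w) y))
    (hg.comp ((measurable_nextRecord π t hf).comp ((hu.comp measurable_fst).prodMk measurable_snd)))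

theorem roundRegret_eq_lintegral (hf : Measurable M.f) (ρ : Measure S) [SFinite ρ] :
    M.roundRegret ρ π t =
      ∫⁻ r, ∫⁻ c, ENNReal.ofReal (M.revenueGap c.1 c.2.1 c.2.2)
        ∂M.contextKernel π t r ∂M.recordLaw π t ρ := by
  have hgap := (measurable_revenueGap hf).ennreal_ofReal
  rw [lintegral_recordLaw hf ρ hgap.lintegral_kernel]
  simp_rw [lintegral_contextKernel hgap]
  rfl

end Probability

end Market

/-! ### Two comparable markets -/

namespace Market

variable {d : ℕ} (M M' : Market d)

/-- The context that an observation reveals in the market `M`, a left inverse of `M.observe`. -/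
def contextOf (o : Observation d) : Context d :=
  (o.feature, o.supply, o.price - M.supplyPrice o.supply o.quantity)

/-- The square root of the likelihood ratio of `M'` to `M` carried by one observation. -/
noncomputable def rootRatio (o : Observation d) : ℝ≥0∞ :=
  gaussianRootRatio (M.meanQuantity (M.contextOf o)) (M'.meanQuantity (M.contextOf o))
    M.quantityVar o.quantity

/-- The square root of the likelihood ratio of `M'` to `M` carried by a record. -/
noncomputable def recordRootRatio {S : Type*} {t : ℕ} (r : Record S d t) : ℝ≥0∞ :=
  ∏ i, M.rootRatio M' (r.2 i)

/-- Up to the factor `8`, the squared signal-to-noise ratio for telling `M'` from `M` by one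
quantity: a bound for how far the Hellinger affinity of its two laws is below `1`. -/
noncomputable def separation (c : Context d) : ℝ≥0∞ :=
  ENNReal.ofReal ((M'.meanQuantity c - M.meanQuantity c) ^ 2 / (8 * M.quantityVar))

/-- The expected separation of `M` and `M'` in round `t` when `π` runs in the market `M`. -/
noncomputable def roundInformation {S : Type*} [MeasurableSpace S] (ρ : Measure S)
    (π : PricingPolicy S d) (t : ℕ) : ℝ≥0∞ :=
  ∫⁻ r, ∫⁻ c, M.separation M' c ∂M.contextKernel π t r ∂M.recordLaw π t ρ

/-- Two markets that differ only in the mean of the equilibrium quantity, so that the laws of the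
records in the two markets are mutually absolutely continuous. -/
structure Comparable : Prop where
  α₀_eq : M'.α₀ = M.α₀
  α₁_eq : M'.α₁ = M.α₁
  ν_eq : M'.ν = M.ν
  σS_eq : M'.σS = M.σS
  quantityVar_eq : M'.quantityVar = M.quantityVar
  quantityVar_ne_zero : M.quantityVar ≠ 0
  measurable_left : Measurable M.f
  measurable_right : Measurable M'.f

theorem contextOf_observe (c : Context d) (q : ℝ) : M.contextOf (M.observe c q) = c := by
  simp [contextOf, observe]

theorem rootRatio_observe (c : Context d) (q : ℝ) :
    M.rootRatio M' (M.observe c q) =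
      gaussianRootRatio (M.meanQuantity c) (M'.meanQuantity c) M.quantityVar q := by
  rw [rootRatio, contextOf_observe]
  rfl

theorem recordRootRatio_snoc {S : Type*} {t : ℕ} (r : Record S d t) (o : Observation d) :
    M.recordRootRatio M' (r.snoc o) = M.recordRootRatio M' r * M.rootRatio M' o := by
  simp [recordRootRatio, Record.snoc, Fin.prod_univ_castSucc]

namespace Comparable

variable {M M'} {S : Type*} [MeasurableSpace S] {ρ : Measure S} {π : PricingPolicy S d} {t : ℕ}

theorem observe_eq (H : Comparable M M') : M'.observe = M.observe := by
  unfold observe supplyPrice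
  rw [H.α₁_eq]

theorem contextKernel_eq (H : Comparable M M') :
    M'.contextKernel π t = M.contextKernel π t := by
  unfold contextKernel context
  rw [H.α₀_eq, H.ν_eq, H.σS_eq]

theorem separation_comm (H : Comparable M M') : M'.separation M = M.separation M' := by
  unfold separation
  rw [H.quantityVar_eq]
  simp_rw [sub_sq_comm (M.meanQuantity _)]

theorem measurable_rootRatio (H : Comparable M M') : Measurable (M.rootRatio M') := by
  have hc : Measurable (M.contextOf (d := d)) := by
    unfold contextOf supplyPrice
    fun_prop
  exact measurable_gaussianRootRatio ((measurable_meanQuantity H.measurable_left).comp hc)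
    ((measurable_meanQuantity H.measurable_right).comp hc) _ Observation.measurable_quantity

theorem measurable_rootRatio_observe (H : Comparable M M') :
    Measurable fun p : Context d × ℝ => M.rootRatio M' (M.observe p.1 p.2) :=
  H.measurable_rootRatio.comp M.measurable_observe

theorem measurable_recordRootRatio (H : Comparable M M') :
    Measurable (M.recordRootRatio M' : Record S d t → ℝ≥0∞) :=
  Finset.measurable_prod _ fun i _ =>
    H.measurable_rootRatio.comp ((measurable_pi_apply i).comp measurable_snd)

theorem measurable_separation (H : Comparable M M') : Measurable (M.separation M') := by
  have hM := measurable_meanQuantity H.measurable_left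
  have hM' := measurable_meanQuantity H.measurable_right
  unfold separation
  fun_prop

theorem lintegral_quantityKernel_right (H : Comparable M M') (c : Context d) {g : ℝ → ℝ≥0∞}
    (hg : Measurable g) :
    ∫⁻ q, g q ∂quantityKernel H.measurable_right c =
      ∫⁻ q, M.rootRatio M' (M.observe c q) ^ 2 * g q ∂quantityKernel H.measurable_left c := by
  have hlaw : quantityKernel H.measurable_right c =
      (quantityKernel H.measurable_left c).withDensity
        fun q => M.rootRatio M' (M.observe c q) ^ 2 := by
    simp_rw [rootRatio_observe]
    change gaussianReal _ _ = (gaussianReal _ _).withDensity _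
    rw [H.quantityVar_eq]
    exact gaussianReal_eq_withDensity_rootRatio_sq _ _ H.quantityVar_ne_zero
  have hratio : Measurable fun q => M.rootRatio M' (M.observe c q) :=
    H.measurable_rootRatio.comp (M.measurable_observe_left c)
  rw [hlaw, lintegral_withDensity_eq_lintegral_mul _ (hratio.pow_const 2) hg]
  rfl

theorem measurable_affinity (H : Comparable M M') :
    Measurable fun c => ∫⁻ q, M.rootRatio M' (M.observe c q) ∂quantityKernel H.measurable_left c :=
  H.measurable_rootRatio_observe.lintegral_kernel_prod_right'

theorem one_le_lintegral_rootRatio_add_separation (H : Comparable M M') (c : Context d) :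
    1 ≤ ∫⁻ q, M.rootRatio M' (M.observe c q) ∂quantityKernel H.measurable_left c
      + M.separation M' c := by
  simp_rw [rootRatio_observe]
  exact one_le_lintegral_gaussianRootRatio_add _ _ H.quantityVar_ne_zero

theorem sq_recordRootRatio_mul_lintegral_round (H : Comparable M M')
    {g : Record S d (t + 1) → ℝ≥0∞} (hg : Measurable g) (r : Record S d t) :
    M.recordRootRatio M' r ^ 2 * ∫⁻ c, ∫⁻ q, g (r.snoc (M'.observe c q))
        ∂quantityKernel H.measurable_right c ∂M'.contextKernel π t r =
      ∫⁻ c, ∫⁻ q, M.recordRootRatio M' (r.snoc (M.observe c q)) ^ 2 * g (r.snoc (M.observe c q))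
        ∂quantityKernel H.measurable_left c ∂M.contextKernel π t r := by
  have hgsnoc : Measurable fun p : Context d × ℝ => g (r.snoc (M.observe p.1 p.2)) :=
    hg.comp (Record.measurable_snoc.comp (measurable_const.prodMk M.measurable_observe))
  rw [H.contextKernel_eq, H.observe_eq, ← lintegral_const_mul _
    (hgsnoc.lintegral_kernel_prod_right' (κ := quantityKernel H.measurable_right))]
  refine lintegral_congr fun c => ?_
  have hgc : Measurable fun q => g (r.snoc (M.observe c q)) :=
    hgsnoc.comp (measurable_prodMk_left (x := c))
  have hratioc : Measurable fun q => M.rootRatio M' (M.observe c q) :=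
    H.measurable_rootRatio.comp (M.measurable_observe_left c)
  rw [H.lintegral_quantityKernel_right c hgc,
    ← lintegral_const_mul _ (by fun_prop)]
  refine lintegral_congr fun q => ?_
  rw [recordRootRatio_snoc, mul_pow, mul_assoc]

section Rounds

variable [IsProbabilityMeasure M.ν]

theorem isProbabilityMeasure_ν (H : Comparable M M') : IsProbabilityMeasure M'.ν := by
  rw [H.ν_eq]
  infer_instance

variable [IsProbabilityMeasure ρ]

theorem recordLaw_eq_withDensity (H : Comparable M M') :
    M'.recordLaw π t ρ =
      (M.recordLaw π t ρ).withDensity fun r => M.recordRootRatio M' r ^ 2 := by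
  have := H.isProbabilityMeasure_ν
  refine Measure.ext_of_lintegral _ fun g hg => ?_
  have hK {n : ℕ} := (H.measurable_recordRootRatio (S := S) (t := n)).pow_const 2
  rw [lintegral_withDensity_eq_lintegral_mul _ hK hg]
  induction t with
  | zero =>
    rw [lintegral_recordLaw H.measurable_right ρ hg,
      lintegral_recordLaw H.measurable_left ρ (hK.mul hg)]
    simp [history, recordRootRatio]
  | succ t ih =>
    rw [lintegral_recordLaw_succ H.measurable_right ρ hg,
      lintegral_recordLaw_succ H.measurable_left ρ (hK.mul hg),
      ih _ (measurable_lintegral_round H.measurable_right hg)]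
    exact lintegral_congr fun r => H.sq_recordRootRatio_mul_lintegral_round hg r

theorem lintegral_recordLaw_right (H : Comparable M M') {g : Record S d t → ℝ≥0∞}
    (hg : Measurable g) :
    ∫⁻ r, g r ∂M'.recordLaw π t ρ =
      ∫⁻ r, M.recordRootRatio M' r ^ 2 * g r ∂M.recordLaw π t ρ := by
  rw [H.recordLaw_eq_withDensity,
    lintegral_withDensity_eq_lintegral_mul _ (H.measurable_recordRootRatio.pow_const 2) hg]
  rfl

theorem lintegral_sq_recordRootRatio (H : Comparable M M') :
    ∫⁻ r, M.recordRootRatio M' r ^ 2 ∂M.recordLaw π t ρ = 1 := by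
  have := H.isProbabilityMeasure_ν
  have := isProbabilityMeasure_recordLaw π t H.measurable_right ρ
  have hone := H.lintegral_recordLaw_right (π := π) (t := t) (ρ := ρ) (measurable_const (a := 1))
  simpa using hone.symm

theorem lintegral_recordRootRatio_succ (H : Comparable M M') :
    ∫⁻ r, M.recordRootRatio M' r ∂M.recordLaw π (t + 1) ρ =
      ∫⁻ r, M.recordRootRatio M' r * ∫⁻ c, ∫⁻ q, M.rootRatio M' (M.observe c q)
        ∂quantityKernel H.measurable_left c ∂M.contextKernel π t r ∂M.recordLaw π t ρ := by
  rw [lintegral_recordLaw_succ H.measurable_left ρ H.measurable_recordRootRatio]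
  refine lintegral_congr fun r => ?_
  rw [← lintegral_const_mul _ H.measurable_affinity]
  refine lintegral_congr fun c => ?_
  have hratioc : Measurable fun q => M.rootRatio M' (M.observe c q) :=
    H.measurable_rootRatio.comp (M.measurable_observe_left c)
  rw [← lintegral_const_mul _ hratioc]
  exact lintegral_congr fun q => recordRootRatio_snoc M M' r _

theorem lintegral_recordRootRatio_le_succ_add (H : Comparable M M') :
    ∫⁻ r, M.recordRootRatio M' r ∂M.recordLaw π t ρ ≤
      ∫⁻ r, M.recordRootRatio M' r ∂M.recordLaw π (t + 1) ρ +
        2⁻¹ * (M.roundInformation M' ρ π t + M'.roundInformation M ρ π t) := by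
  have hone_le (r : Record S d t) : 1 ≤ ∫⁻ c, ∫⁻ q, M.rootRatio M' (M.observe c q)
      ∂quantityKernel H.measurable_left c ∂M.contextKernel π t r +
        ∫⁻ c, M.separation M' c ∂M.contextKernel π t r := by
    rw [← lintegral_add_left H.measurable_affinity]
    calc 1 = ∫⁻ _, 1 ∂M.contextKernel π t r := by simp
      _ ≤ _ := lintegral_mono H.one_le_lintegral_rootRatio_add_separation
  rw [H.lintegral_recordRootRatio_succ, roundInformation, roundInformation, H.contextKernel_eq,
    H.separation_comm, H.lintegral_recordLaw_right H.measurable_separation.lintegral_kernel]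
  exact lintegral_le_lintegral_mul_add H.measurable_recordRootRatio
    H.measurable_affinity.lintegral_kernel
    H.measurable_separation.lintegral_kernel hone_le

theorem one_le_lintegral_recordRootRatio_add_sum (H : Comparable M M') :
    1 ≤ ∫⁻ r, M.recordRootRatio M' r ∂M.recordLaw π t ρ + 2⁻¹ * ∑ i ∈ Finset.range t,
      (M.roundInformation M' ρ π i + M'.roundInformation M ρ π i) := by
  induction t with
  | zero =>
    have := isProbabilityMeasure_recordLaw π 0 H.measurable_left ρ
    simp [recordRootRatio]
  | succ t ih =>
    rw [Finset.sum_range_succ, mul_add, add_comm (2⁻¹ * _), ← add_assoc]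
    exact ih.trans (add_le_add H.lintegral_recordRootRatio_le_succ_add le_rfl)

/- Le Cam's two-point method: as long as the two markets cannot be told apart, a fee that suits one
of them does not suit the other. -/
theorem le_four_mul_roundRegret_add (H : Comparable M M') {Δ : ℝ≥0∞} (hΔ : Δ ≠ ∞)
    (hgap : ∀ r : Record S d t,
      Δ ≤ ∫⁻ c, ENNReal.ofReal (M.revenueGap c.1 c.2.1 c.2.2) ∂M.contextKernel π t r +
        ∫⁻ c, ENNReal.ofReal (M'.revenueGap c.1 c.2.1 c.2.2) ∂M.contextKernel π t r)
    (hinfo : ∑ i ∈ Finset.range t,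
      (M.roundInformation M' ρ π i + M'.roundInformation M ρ π i) ≤ 2⁻¹) :
    Δ ≤ 4 * (M.roundRegret ρ π t + M'.roundRegret ρ π t) := by
  have := H.isProbabilityMeasure_ν
  have := isProbabilityMeasure_recordLaw π t H.measurable_left ρ
  have hM := (measurable_revenueGap H.measurable_left).ennreal_ofReal
  have hM' := (measurable_revenueGap H.measurable_right).ennreal_ofReal
  have htest := mul_lintegral_le_of_le_add (P := M.recordLaw π t ρ) H.measurable_recordRootRatio
    hM.lintegral_kernel hM'.lintegral_kernel H.lintegral_sq_recordRootRatio hgap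
  rw [← roundRegret_eq_lintegral H.measurable_left,
    ← H.lintegral_recordLaw_right hM'.lintegral_kernel, ← H.contextKernel_eq,
    ← roundRegret_eq_lintegral H.measurable_right] at htest
  have haff : 1 ≤ ∫⁻ r, M.recordRootRatio M' r ∂M.recordLaw π t ρ + 4⁻¹ := by
    refine H.one_le_lintegral_recordRootRatio_add_sum.trans (add_le_add le_rfl ?_)
    rw [← inv_two_mul_inv_two]
    gcongr
  refine le_four_mul_of_le_add hΔ ?_
  calc Δ = Δ * 1 := (mul_one Δ).symm
    _ ≤ Δ * (∫⁻ r, M.recordRootRatio M' r ∂M.recordLaw π t ρ + 4⁻¹) := by gcongr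
    _ ≤ _ := by
      rw [mul_add, mul_comm Δ 4⁻¹]
      gcongr

end Rounds

end Comparable

end Market

/-! ### The hard family -/

/-- A one-parameter family of markets that are hard to tell apart. The coefficients of the mean
quantity `θ₀ - θ₁ (ε_S + a)` lie on the parabola `θ₀ ^ 2 ∝ θ₁`, see `meanQuantity_market`. At the
parameter value `1`, the slope `α₁ - β` is `κ`, the constant value of `f` is `α₀ + m` and the demand
noise is `s`. -/
structure HardFamily where
  α₀ : ℝ
  α₁ : ℝ
  κ : ℝ
  m : ℝ
  s : ℝ
  κ_pos : 0 < κ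
  m_pos : 0 < m
  s_pos : 0 < s

namespace HardFamily

/-- The market with parameter `τ` of the family. The demand noise has the size that gives all
equilibrium quantities the same variance. -/
noncomputable def market (H : HardFamily) {d : ℕ} (ν : Measure (Fin d → ℝ)) (σS τ : ℝ) :
    Market d where
  α₀ := H.α₀
  α₁ := H.α₁
  β := H.α₁ - H.κ / τ ^ 2
  f := fun _ => H.α₀ + H.m / τ
  ν := ν
  σS := σS
  σD := H.s / τ ^ 2

variable (H : HardFamily) {d : ℕ} {ν : Measure (Fin d → ℝ)} {σS τ τ' : ℝ}

instance [IsProbabilityMeasure ν] : IsProbabilityMeasure (H.market ν σS τ).ν := ‹_›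

theorem β_lt_α₁_market (hτ : 0 < τ) : (H.market ν σS τ).β < (H.market ν σS τ).α₁ :=
  sub_lt_self _ (div_pos H.κ_pos (pow_pos hτ 2))

theorem meanQuantity_market (hτ : 0 < τ) (c : Context d) :
    (H.market ν σS τ).meanQuantity c =
      (H.m * τ - τ ^ 2 * (c.2.1 - H.α₀ + c.2.2)) / H.κ := by
  simp only [Market.meanQuantity, market, sub_sub_cancel]
  rw [div_div_eq_mul_div]
  congr 1
  field_simp
  ring

theorem quantityVar_market (hτ : 0 < τ) :
    (H.market ν σS τ).quantityVar = Real.toNNReal ((H.s / H.κ) ^ 2) := by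
  simp only [Market.quantityVar, market, sub_sub_cancel]
  congr 2
  field_simp

theorem comparable_market (hτ : 0 < τ) (hτ' : 0 < τ') :
    Market.Comparable (H.market ν σS τ) (H.market ν σS τ') where
  α₀_eq := rfl
  α₁_eq := rfl
  ν_eq := rfl
  σS_eq := rfl
  quantityVar_eq := by rw [H.quantityVar_market hτ, H.quantityVar_market hτ']
  quantityVar_ne_zero := by
    rw [H.quantityVar_market hτ, ne_eq, Real.toNNReal_eq_zero, not_le]
    exact pow_pos (div_pos H.s_pos H.κ_pos) 2
  measurable_left := measurable_const
  measurable_right := measurable_const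

theorem optimalFee_market (x : Fin d → ℝ) (z : ℝ) :
    (H.market ν σS τ).optimalFee x z = max 0 ((H.m / τ - (z - H.α₀)) / 2) := by
  simp only [Market.optimalFee, market]
  ring_nf

theorem measurable_revenueGap_market :
    Measurable fun c : Context d =>
      ENNReal.ofReal ((H.market ν σS τ).revenueGap c.1 c.2.1 c.2.2) :=
  (Market.measurable_revenueGap measurable_const).ennreal_ofReal

theorem sq_sub_optimalFee_le_mul_revenueGap (hτ : 1 ≤ τ) (x : Fin d → ℝ) (z : ℝ) {a : ℝ}
    (ha : 0 ≤ a) :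
    (a - (H.market ν σS τ).optimalFee x z) ^ 2 ≤ H.κ * (H.market ν σS τ).revenueGap x z a := by
  have hslope := H.β_lt_α₁_market (ν := ν) (σS := σS) (one_pos.trans_le hτ)
  have hslope_eq : (H.market ν σS τ).α₁ - (H.market ν σS τ).β = H.κ / τ ^ 2 := sub_sub_cancel _ _
  have hgap := (H.market ν σS τ).sq_sub_optimalFee_le_revenueGap hslope x z ha
  rw [div_le_iff₀' (sub_pos.2 hslope), hslope_eq] at hgap
  exact hgap.trans (mul_le_mul_of_nonneg_right (div_le_self H.κ_pos.le (one_le_pow₀ hτ))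
    (Market.revenueGap_nonneg _ hslope x z a ha))

/- Without supply noise, the optimal fee is `H.m / (2 * τ)`, the very value of `z - H.α₀ + a` at
which the derivative of `meanQuantity_market` in `τ` vanishes. -/
theorem sq_noise_add_optimalFee_sub_le (hτ : 0 < τ) (x : Fin d → ℝ) (z : ℝ) :
    (z - H.α₀ + (H.market ν σS τ).optimalFee x z - H.m / τ / 2) ^ 2 ≤ (z - H.α₀) ^ 2 := by
  have hb : 0 < H.m / τ := div_pos H.m_pos hτ
  rw [optimalFee_market]
  rcases le_total 0 ((H.m / τ - (z - H.α₀)) / 2) with hfee | hfee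
  · rw [max_eq_right hfee]
    nlinarith [sq_nonneg (z - H.α₀)]
  · rw [max_eq_left hfee]
    nlinarith

theorem meanQuantity_market_sub (hτ : 0 < τ) (hτ' : 0 < τ') (c : Context d) :
    (H.market ν σS τ').meanQuantity c - (H.market ν σS τ).meanQuantity c =
      (τ' - τ) * (H.m - (τ + τ') * (c.2.1 - H.α₀ + c.2.2)) / H.κ := by
  rw [H.meanQuantity_market hτ', H.meanQuantity_market hτ]
  ring

theorem sq_sub_mul_noise_add_fee_le (hτ : τ ∈ Set.Icc 1 2) (hτ' : τ' ∈ Set.Icc 1 2) (x : Fin d → ℝ)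
    (z a : ℝ) :
    (H.m - (τ + τ') * (z - H.α₀ + a)) ^ 2 ≤
      48 * ((a - (H.market ν σS τ).optimalFee x z) ^ 2 + (z - H.α₀) ^ 2) +
        H.m ^ 2 * (τ' - τ) ^ 2 := by
  obtain ⟨hτ1, hτ2⟩ := hτ
  obtain ⟨hτ1', hτ2'⟩ := hτ'
  have hτ0 : 0 < τ := one_pos.trans_le hτ1
  have hnoise := H.sq_noise_add_optimalFee_sub_le (ν := ν) (σS := σS) hτ0 x z
  set u := a - (H.market ν σS τ).optimalFee x z
  set v := z - H.α₀ + (H.market ν σS τ).optimalFee x z - H.m / τ / 2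
  have hsplit : H.m - (τ + τ') * (z - H.α₀ + a) =
      -((τ + τ') * u) - (τ + τ') * v - H.m / τ * (τ' - τ) / 2 := by
    simp only [u, v]
    field_simp
    ring
  have hcauchy (x y w : ℝ) : (-x - y - w) ^ 2 ≤ 3 * (x ^ 2 + y ^ 2 + w ^ 2) := by
    nlinarith [sq_nonneg (x - y), sq_nonneg (y - w), sq_nonneg (x - w)]
  have hsum : (τ + τ') ^ 2 ≤ 16 := by nlinarith
  have hu : ((τ + τ') * u) ^ 2 ≤ 16 * u ^ 2 := by rw [mul_pow]; gcongr
  have hv : ((τ + τ') * v) ^ 2 ≤ 16 * (z - H.α₀) ^ 2 := by rw [mul_pow]; gcongr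
  have hw : (H.m / τ * (τ' - τ) / 2) ^ 2 ≤ H.m ^ 2 * (τ' - τ) ^ 2 / 4 := by
    rw [div_pow, mul_pow]
    norm_num only
    gcongr
    exacts [(div_pos H.m_pos hτ0).le, div_le_self H.m_pos.le hτ1]
  rw [hsplit]
  nlinarith [hcauchy ((τ + τ') * u) ((τ + τ') * v) (H.m / τ * (τ' - τ) / 2),
    mul_nonneg (sq_nonneg H.m) (sq_nonneg (τ' - τ))]

theorem separation_market_le (hτ : τ ∈ Set.Icc 1 2) (hτ' : τ' ∈ Set.Icc 1 2) {c : Context d}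
    (hc : 0 ≤ c.2.2) :
    (H.market ν σS τ).separation (H.market ν σS τ') c ≤
      ENNReal.ofReal ((τ' - τ) ^ 2 / (8 * H.s ^ 2)) *
        (ENNReal.ofReal (48 * H.κ) *
            ENNReal.ofReal ((H.market ν σS τ).revenueGap c.1 c.2.1 c.2.2) +
          (ENNReal.ofReal 48 * ENNReal.ofReal ((c.2.1 - H.α₀) ^ 2) +
            ENNReal.ofReal (H.m ^ 2 * (τ' - τ) ^ 2))) := by
  have hτ0 : 0 < τ := one_pos.trans_le hτ.1
  have hκ := H.κ_pos
  have hs := H.s_pos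
  have hgap := H.sq_sub_optimalFee_le_mul_revenueGap (ν := ν) (σS := σS) hτ.1 c.1 c.2.1 hc
  have hgap0 := Market.revenueGap_nonneg _ (H.β_lt_α₁_market (ν := ν) (σS := σS) hτ0)
    c.1 c.2.1 c.2.2 hc
  have hshift := H.sq_sub_mul_noise_add_fee_le (ν := ν) (σS := σS) hτ hτ' c.1 c.2.1 c.2.2
  rw [← ENNReal.ofReal_mul (by positivity), ← ENNReal.ofReal_mul (by positivity),
    ← ENNReal.ofReal_add (by positivity) (by positivity),
    ← ENNReal.ofReal_add (by positivity) (by positivity), ← ENNReal.ofReal_mul (by positivity),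
    Market.separation, H.meanQuantity_market_sub hτ0 (one_pos.trans_le hτ'.1),
    H.quantityVar_market hτ0, Real.coe_toNNReal _ (sq_nonneg _)]
  refine ENNReal.ofReal_le_ofReal ?_
  calc ((τ' - τ) * (H.m - (τ + τ') * (c.2.1 - H.α₀ + c.2.2)) / H.κ) ^ 2 / (8 * (H.s / H.κ) ^ 2)
    _ = (τ' - τ) ^ 2 / (8 * H.s ^ 2) * (H.m - (τ + τ') * (c.2.1 - H.α₀ + c.2.2)) ^ 2 := by
      field_simp
    _ ≤ _ := by
      gcongr
      linarith

theorem revenueGap_add_ge (hτ : τ ∈ Set.Icc 1 2) (hτ' : τ' ∈ Set.Icc 1 2) (x : Fin d → ℝ)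
    {z a : ℝ} (hz : z ≤ H.α₀) (ha : 0 ≤ a) :
    H.m ^ 2 * (τ' - τ) ^ 2 / (128 * H.κ) ≤
      (H.market ν σS τ).revenueGap x z a + (H.market ν σS τ').revenueGap x z a := by
  obtain ⟨hτ1, hτ2⟩ := hτ
  obtain ⟨hτ1', hτ2'⟩ := hτ'
  have hκ := H.κ_pos
  have hm := H.m_pos
  have hτ0 : 0 < τ := one_pos.trans_le hτ1
  have hτ0' : 0 < τ' := one_pos.trans_le hτ1'
  have hgap := H.sq_sub_optimalFee_le_mul_revenueGap (ν := ν) (σS := σS) hτ1 x z ha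
  have hgap' := H.sq_sub_optimalFee_le_mul_revenueGap (ν := ν) (σS := σS) hτ1' x z ha
  set p := (H.market ν σS τ).optimalFee x z with hp
  set p' := (H.market ν σS τ').optimalFee x z with hp'
  have hfees : p - p' = H.m * (τ' - τ) / (2 * (τ * τ')) := by
    rw [hp, hp', optimalFee_market, optimalFee_market,
      max_eq_right (by linarith [div_pos hm hτ0]), max_eq_right (by linarith [div_pos hm hτ0'])]
    field_simp
    ring
  have hfees_ge : H.m ^ 2 * (τ' - τ) ^ 2 / 64 ≤ (p - p') ^ 2 := by
    rw [hfees, div_pow, mul_pow]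
    have hprod : τ * τ' ≤ 4 := by nlinarith
    gcongr
    nlinarith [mul_pos hτ0 hτ0']
  rw [div_le_iff₀ (by positivity)]
  nlinarith [sq_nonneg (a - p + (a - p'))]

section Regret

variable [IsProbabilityMeasure ν] {S : Type*} [MeasurableSpace S] {ρ : Measure S}
  [IsProbabilityMeasure ρ] {π : PricingPolicy S d} {t : ℕ}

theorem roundInformation_market_le (hτ : τ ∈ Set.Icc 1 2) (hτ' : τ' ∈ Set.Icc 1 2) :
    (H.market ν σS τ).roundInformation (H.market ν σS τ') ρ π t ≤
      ENNReal.ofReal ((τ' - τ) ^ 2 / (8 * H.s ^ 2)) *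
        (ENNReal.ofReal (48 * H.κ) * (H.market ν σS τ).roundRegret ρ π t +
          ENNReal.ofReal (48 * σS ^ 2 + H.m ^ 2 * (τ' - τ) ^ 2)) := by
  have hcomp := H.comparable_market (ν := ν) (σS := σS) (one_pos.trans_le hτ.1)
    (one_pos.trans_le hτ'.1)
  have hprob := Market.isProbabilityMeasure_recordLaw π t hcomp.measurable_left ρ
  have hgap := H.measurable_revenueGap_market (ν := ν) (σS := σS) (τ := τ)
  have hnoise (r : Record S d t) : ∫⁻ c, ENNReal.ofReal ((c.2.1 - H.α₀) ^ 2)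
      ∂(H.market ν σS τ).contextKernel π t r = ENNReal.ofReal (σS ^ 2) :=
    (Market.lintegral_contextKernel_of_supply (M := H.market ν σS τ)
      (g := fun e => ENNReal.ofReal (e ^ 2)) (by fun_prop) r).trans
      (lintegral_sq_centeredGaussian σS)
  have hround (r : Record S d t) :
      ∫⁻ c, (H.market ν σS τ).separation (H.market ν σS τ') c
          ∂(H.market ν σS τ).contextKernel π t r ≤
        ENNReal.ofReal ((τ' - τ) ^ 2 / (8 * H.s ^ 2)) * (ENNReal.ofReal (48 * H.κ) *
          ∫⁻ c, ENNReal.ofReal ((H.market ν σS τ).revenueGap c.1 c.2.1 c.2.2)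
            ∂(H.market ν σS τ).contextKernel π t r +
          ENNReal.ofReal (48 * σS ^ 2 + H.m ^ 2 * (τ' - τ) ^ 2)) := by
    refine (Market.lintegral_contextKernel_mono hcomp.measurable_separation (by fun_prop)
      (fun c => H.separation_market_le hτ hτ') r).trans_eq ?_
    rw [lintegral_const_mul _ (by fun_prop), lintegral_add_left (by fun_prop),
      lintegral_const_mul _ hgap, lintegral_add_left (by fun_prop),
      lintegral_const_mul _ (by fun_prop), hnoise, lintegral_const, measure_univ, mul_one,
      ← ENNReal.ofReal_mul (by positivity), ← ENNReal.ofReal_add (by positivity) (by positivity)]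
  refine (lintegral_mono hround).trans_eq ?_
  rw [lintegral_const_mul' _ _ ENNReal.ofReal_ne_top, lintegral_add_right _ measurable_const,
    lintegral_const_mul' _ _ ENNReal.ofReal_ne_top, lintegral_const, measure_univ, mul_one,
    ← Market.roundRegret_eq_lintegral hcomp.measurable_left]

theorem sum_roundInformation_market_le (hτ : τ ∈ Set.Icc 1 2) (hτ' : τ' ∈ Set.Icc 1 2) {R : ℝ}
    (hR : 0 ≤ R)
    (hreg : (H.market ν σS τ).regret ρ π t ≤ ENNReal.ofReal R) :
    ∑ i ∈ Finset.range t, (H.market ν σS τ).roundInformation (H.market ν σS τ') ρ π i ≤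
      ENNReal.ofReal ((τ' - τ) ^ 2 / (8 * H.s ^ 2) *
        (48 * H.κ * R + t * (48 * σS ^ 2 + H.m ^ 2 * (τ' - τ) ^ 2))) := by
  have hκ := H.κ_pos
  have hs := H.s_pos
  calc ∑ i ∈ Finset.range t, (H.market ν σS τ).roundInformation (H.market ν σS τ') ρ π i
    _ ≤ ∑ i ∈ Finset.range t, ENNReal.ofReal ((τ' - τ) ^ 2 / (8 * H.s ^ 2)) *
        (ENNReal.ofReal (48 * H.κ) * (H.market ν σS τ).roundRegret ρ π i +
          ENNReal.ofReal (48 * σS ^ 2 + H.m ^ 2 * (τ' - τ) ^ 2)) :=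
      Finset.sum_le_sum fun i _ => H.roundInformation_market_le hτ hτ'
    _ = ENNReal.ofReal ((τ' - τ) ^ 2 / (8 * H.s ^ 2)) *
        (ENNReal.ofReal (48 * H.κ) * (H.market ν σS τ).regret ρ π t +
          t * ENNReal.ofReal (48 * σS ^ 2 + H.m ^ 2 * (τ' - τ) ^ 2)) := by
      rw [← Finset.mul_sum, Finset.sum_add_distrib, ← Finset.mul_sum, Finset.sum_const,
        Finset.card_range, nsmul_eq_mul, Market.regret]
    _ ≤ ENNReal.ofReal ((τ' - τ) ^ 2 / (8 * H.s ^ 2)) *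
        (ENNReal.ofReal (48 * H.κ) * ENNReal.ofReal R +
          t * ENNReal.ofReal (48 * σS ^ 2 + H.m ^ 2 * (τ' - τ) ^ 2)) := by gcongr
    _ = _ := by
      rw [← ENNReal.ofReal_natCast t, ← ENNReal.ofReal_mul (by positivity),
        ← ENNReal.ofReal_mul (by positivity),
        ← ENNReal.ofReal_add (by positivity) (by positivity),
        ← ENNReal.ofReal_mul (by positivity)]

theorem le_lintegral_revenueGap_add (hτ : τ ∈ Set.Icc 1 2) (hτ' : τ' ∈ Set.Icc 1 2)
    (r : Record S d t) :
    ENNReal.ofReal (H.m ^ 2 * (τ' - τ) ^ 2 / (256 * H.κ)) ≤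
      ∫⁻ c, ENNReal.ofReal ((H.market ν σS τ).revenueGap c.1 c.2.1 c.2.2)
          ∂(H.market ν σS τ).contextKernel π t r +
        ∫⁻ c, ENNReal.ofReal ((H.market ν σS τ').revenueGap c.1 c.2.1 c.2.2)
          ∂(H.market ν σS τ).contextKernel π t r := by
  have hgap := H.measurable_revenueGap_market (ν := ν) (σS := σS) (τ := τ)
  have hgap' := H.measurable_revenueGap_market (ν := ν) (σS := σS) (τ := τ')
  have hhalf : ENNReal.ofReal (H.m ^ 2 * (τ' - τ) ^ 2 / (256 * H.κ)) =
      2⁻¹ * ENNReal.ofReal (H.m ^ 2 * (τ' - τ) ^ 2 / (128 * H.κ)) := by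
    rw [← ENNReal.ofReal_ofNat 2, ← ENNReal.ofReal_inv_of_pos two_pos,
      ← ENNReal.ofReal_mul (by positivity)]
    ring_nf
  rw [hhalf, ← lintegral_add_left hgap]
  refine Market.half_mul_le_lintegral_contextKernel (hgap.add hgap') r fun c hz ha => ?_
  exact (ENNReal.ofReal_le_ofReal (H.revenueGap_add_ge hτ hτ' c.1 hz ha)).trans
    ENNReal.ofReal_add_le

theorem le_roundRegret_market_add (hτ : τ ∈ Set.Icc 1 2) (hτ' : τ' ∈ Set.Icc 1 2) {R : ℝ}
    (hR : 0 ≤ R) (hreg : (H.market ν σS τ).regret ρ π t ≤ ENNReal.ofReal R)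
    (hreg' : (H.market ν σS τ').regret ρ π t ≤ ENNReal.ofReal R)
    (hclose : (τ' - τ) ^ 2 * (48 * H.κ * R + t * (48 * σS ^ 2 + H.m ^ 2 * (τ' - τ) ^ 2)) ≤
      2 * H.s ^ 2) :
    ENNReal.ofReal (H.m ^ 2 * (τ' - τ) ^ 2 / (1024 * H.κ)) ≤
      (H.market ν σS τ).roundRegret ρ π t + (H.market ν σS τ').roundRegret ρ π t := by
  have hκ := H.κ_pos
  have hs := H.s_pos
  have hcomp := H.comparable_market (ν := ν) (σS := σS) (one_pos.trans_le hτ.1)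
    (one_pos.trans_le hτ'.1)
  have hinfo : ∑ i ∈ Finset.range t,
      ((H.market ν σS τ).roundInformation (H.market ν σS τ') ρ π i +
        (H.market ν σS τ').roundInformation (H.market ν σS τ) ρ π i) ≤ 2⁻¹ := by
    have hsum' := H.sum_roundInformation_market_le (π := π) hτ' hτ hR hreg'
    rw [sub_sq_comm τ τ'] at hsum'
    rw [Finset.sum_add_distrib]
    refine (add_le_add (H.sum_roundInformation_market_le hτ hτ' hR hreg) hsum').trans ?_
    rw [← ENNReal.ofReal_add (by positivity) (by positivity)]
    refine ENNReal.ofReal_le_of_le_toReal ?_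
    rw [ENNReal.toReal_inv, ENNReal.toReal_ofNat, div_mul_eq_mul_div, ← add_div,
      div_le_iff₀ (by positivity)]
    linarith
  have htwo := hcomp.le_four_mul_roundRegret_add ENNReal.ofReal_ne_top
    (fun r => H.le_lintegral_revenueGap_add hτ hτ' r) hinfo
  have hquarter : ENNReal.ofReal (H.m ^ 2 * (τ' - τ) ^ 2 / (1024 * H.κ)) =
      ENNReal.ofReal (H.m ^ 2 * (τ' - τ) ^ 2 / (256 * H.κ)) / 4 := by
    rw [← ENNReal.ofReal_ofNat 4, ← ENNReal.ofReal_div_of_pos four_pos]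
    ring_nf
  rw [hquarter]
  exact ENNReal.div_le_of_le_mul' htwo

end Regret

end HardFamily

/-! ### Averaging over the family -/

theorem exists_shift_mem_Icc {D y : ℝ} {N : ℕ} (hD : 0 < D) (hy : 0 < y) (hyD : y ≤ D / 2)
    (hN : D ≤ N * y) : ∃ n : ℕ, 2 * n ≤ N ∧ D * n / N ∈ Set.Icc (y / 2) y := by
  have hN0 : (0 : ℝ) < N := pos_of_mul_pos_left (hD.trans_le hN) hy.le
  have hone : 1 ≤ N * y / D := by rwa [le_div_iff₀ hD, one_mul]
  have hn_le : (⌊N * y / D⌋₊ : ℝ) ≤ N * y / D := Nat.floor_le (by positivity)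
  have hn_ge : N * y / D < ⌊N * y / D⌋₊ + 1 := Nat.lt_floor_add_one _
  have hn_one : (1 : ℝ) ≤ ⌊N * y / D⌋₊ := by exact_mod_cast (Nat.one_le_floor_iff _).2 hone
  set n := ⌊N * y / D⌋₊
  rw [le_div_iff₀' hD] at hn_le
  rw [div_lt_iff₀' hD] at hn_ge
  refine ⟨n, ?_, ?_, ?_⟩
  · have h2n : D * (2 * n) ≤ D * N := by nlinarith
    exact_mod_cast le_of_mul_le_mul_left h2n hD
  · rw [le_div_iff₀ hN0]
    nlinarith
  · rwa [div_le_iff₀' hN0]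

theorem one_add_mul_div_mem_Icc {D : ℝ} {j N : ℕ} (hD : 0 ≤ D) (hj : j ≤ N) :
    1 + D * j / N ∈ Set.Icc 1 (1 + D) := by
  refine ⟨le_add_of_nonneg_right (by positivity), ?_⟩
  rw [mul_div_assoc]
  gcongr
  exact mul_le_of_le_one_right hD (div_le_one_of_le₀ (by exact_mod_cast hj) (by positivity))

theorem mul_le_four_mul_sum_of_le_add_shift (f : ℕ → ℝ≥0∞) {n N : ℕ} (hn : 2 * n ≤ N) {B : ℝ≥0∞}
    (hB : ∀ j, j + n < N → B ≤ f j + f (j + n)) :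
    N * B ≤ 4 * ∑ j ∈ Finset.range N, f j := by
  have hpairs : ((N - n : ℕ) : ℝ≥0∞) * B ≤ 2 * ∑ j ∈ Finset.range N, f j := by
    calc ((N - n : ℕ) : ℝ≥0∞) * B = ∑ _j ∈ Finset.range (N - n), B := by simp
      _ ≤ ∑ j ∈ Finset.range (N - n), (f j + f (j + n)) :=
        Finset.sum_le_sum fun j hj => hB j (by have := Finset.mem_range.1 hj; omega)
      _ = ∑ j ∈ Finset.range (N - n), f j + ∑ j ∈ Finset.range (N - n), f (n + j) := by
        rw [Finset.sum_add_distrib]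
        simp_rw [add_comm n]
      _ ≤ ∑ j ∈ Finset.range N, f j + ∑ j ∈ Finset.range N, f j := by
        refine add_le_add (Finset.sum_le_sum_of_subset (Finset.range_mono (by omega))) ?_
        conv_rhs => rw [show N = n + (N - n) by omega, Finset.sum_range_add]
        exact le_add_self
      _ = 2 * ∑ j ∈ Finset.range N, f j := (two_mul _).symm
  calc (N : ℝ≥0∞) * B ≤ ((2 * (N - n) : ℕ) : ℝ≥0∞) * B := by
        gcongr
        omega
    _ = 2 * (((N - n : ℕ) : ℝ≥0∞) * B) := by push_cast; ring
    _ ≤ 2 * (2 * ∑ j ∈ Finset.range N, f j) := by gcongr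
    _ = 4 * ∑ j ∈ Finset.range N, f j := by rw [← mul_assoc]; norm_num

/-- The squared distance, up to the constant `η`, below which two parameters of a hard family cannot
be told apart after `t` rounds with regret at most `√T`. -/
noncomputable def resolution (η σ : ℝ) (T t : ℕ) : ℝ := η / (√T + σ ^ 2 * t)

section Resolution

variable {η σ : ℝ} {T t : ℕ}

theorem sqrt_add_sq_mul_pos (hT : 1 ≤ T) : 0 < √T + σ ^ 2 * t := by
  have : 0 < √(T : ℝ) := Real.sqrt_pos.2 (by exact_mod_cast hT)
  positivity

theorem resolution_pos (hη : 0 < η) (hT : 1 ≤ T) : 0 < resolution η σ T t :=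
  div_pos hη (sqrt_add_sq_mul_pos hT)

theorem resolution_le_resolution (hη : 0 < η) (hT : 1 ≤ T) (ht : t ≤ T) :
    resolution η σ T T ≤ resolution η σ T t := by
  have := sqrt_add_sq_mul_pos (σ := σ) (t := t) hT
  unfold resolution
  gcongr

theorem resolution_mul_add (hT : 1 ≤ T) :
    resolution η σ T t * √T + resolution η σ T t * (σ ^ 2 * t) = η := by
  rw [← mul_add, resolution, div_mul_cancel₀ _ (sqrt_add_sq_mul_pos hT).ne']

theorem resolution_mul_sqrt_le (hη : 0 < η) (hT : 1 ≤ T) : resolution η σ T t * √T ≤ η := by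
  have := resolution_pos (σ := σ) (t := t) hη hT
  exact (le_add_of_nonneg_right (by positivity)).trans_eq (resolution_mul_add hT)

theorem resolution_mul_sq_mul_le (hη : 0 < η) (hT : 1 ≤ T) :
    resolution η σ T t * (σ ^ 2 * t) ≤ η := by
  have := resolution_pos (σ := σ) (t := t) hη hT
  exact (le_add_of_nonneg_left (by positivity)).trans_eq (resolution_mul_add hT)

theorem resolution_le (hη : 0 < η) (hT : 1 ≤ T) : resolution η σ T t ≤ η :=
  (le_mul_of_one_le_right (resolution_pos hη hT).le
    (Real.one_le_sqrt.2 (by exact_mod_cast hT))).trans (resolution_mul_sqrt_le hη hT)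

theorem resolution_sq_mul_le (hη : 0 < η) (hT : 1 ≤ T) (ht : t ≤ T) :
    resolution η σ T t ^ 2 * t ≤ η ^ 2 := by
  have := resolution_pos (σ := σ) (t := t) hη hT
  calc resolution η σ T t ^ 2 * t ≤ resolution η σ T t ^ 2 * T := by gcongr
    _ = (resolution η σ T t * √T) ^ 2 := by rw [mul_pow, Real.sq_sqrt T.cast_nonneg]
    _ ≤ η ^ 2 := by
      gcongr
      exact resolution_mul_sqrt_le hη hT

theorem log_sub_log_le_sum_div {X v : ℝ} (hX : 0 < X) (hv : 0 ≤ v) (n : ℕ) :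
    Real.log (X + v * n) - Real.log X ≤ ∑ t ∈ Finset.range n, v / (X + v * t) := by
  induction n with
  | zero => simp
  | succ n ih =>
    have hn : 0 < X + v * n := by positivity
    have hn' : 0 < X + v * (n + 1 : ℕ) := by positivity
    have hlog := Real.log_le_sub_one_of_pos (div_pos hn' hn)
    rw [Real.log_div hn'.ne' hn.ne'] at hlog
    have hstep : (X + v * (n + 1 : ℕ)) / (X + v * n) - 1 = v / (X + v * n) := by
      push_cast
      field_simp
      ring
    rw [Finset.sum_range_succ]
    linarith

theorem mul_log_div_le_sum_resolution (hη : 0 < η) (hσ : 0 < σ) (hT : 1 ≤ T) :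
    η * (Real.log (1 + σ ^ 2 * √T) / σ ^ 2) ≤ ∑ t ∈ Finset.range T, resolution η σ T t := by
  have hX : 0 < √(T : ℝ) := Real.sqrt_pos.2 (by exact_mod_cast hT)
  have hlog := log_sub_log_le_sum_div hX (sq_nonneg σ) T
  have hquot : (√(T : ℝ) + σ ^ 2 * T) / √T = 1 + σ ^ 2 * √T := by
    nth_rewrite 2 [← Real.mul_self_sqrt T.cast_nonneg]
    field_simp
  rw [← Real.log_div (by positivity) hX.ne', hquot] at hlog
  calc η * (Real.log (1 + σ ^ 2 * √T) / σ ^ 2)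
    _ ≤ η * ((∑ t ∈ Finset.range T, σ ^ 2 / (√T + σ ^ 2 * t)) / σ ^ 2) := by gcongr
    _ = ∑ t ∈ Finset.range T, resolution η σ T t := by
      rw [Finset.sum_div, Finset.mul_sum]
      refine Finset.sum_congr rfl fun t _ => ?_
      rw [resolution]
      field_simp

end Resolution

theorem Market.regret_mono {d : ℕ} (M : Market d) {S : Type*} [MeasurableSpace S] (ρ : Measure S)
    (π : PricingPolicy S d) : Monotone (M.regret ρ π) := fun _ _ htT =>
  Finset.sum_le_sum_of_subset (Finset.range_mono htT)

namespace HardFamily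

variable (H : HardFamily) {d : ℕ} {ν : Measure (Fin d → ℝ)} {σS D η : ℝ} {T : ℕ}

theorem close_of_sq_le_resolution (hη : 0 < η) (hη1 : η ≤ 1)
    (hηs : η * (48 * H.κ + 48 + H.m ^ 2) ≤ 2 * H.s ^ 2) {t : ℕ} (hT : 1 ≤ T) (ht : t ≤ T) {δ : ℝ}
    (hδ : δ ^ 2 ≤ resolution η σS T t) :
    δ ^ 2 * (48 * H.κ * √T + t * (48 * σS ^ 2 + H.m ^ 2 * δ ^ 2)) ≤ 2 * H.s ^ 2 := by
  have hκ := H.κ_pos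
  have hpos := resolution_pos (σ := σS) (t := t) hη hT
  have hsqrt := resolution_mul_sqrt_le (σ := σS) (t := t) hη hT
  have hnoise := resolution_mul_sq_mul_le (σ := σS) (t := t) hη hT
  have hsq := (resolution_sq_mul_le (σ := σS) hη hT ht).trans
    (pow_le_of_le_one hη.le hη1 two_ne_zero)
  set x := resolution η σS T t
  calc δ ^ 2 * (48 * H.κ * √T + t * (48 * σS ^ 2 + H.m ^ 2 * δ ^ 2))
    _ ≤ x * (48 * H.κ * √T + t * (48 * σS ^ 2 + H.m ^ 2 * x)) := by gcongr
    _ = 48 * H.κ * (x * √T) + 48 * (x * (σS ^ 2 * t)) + H.m ^ 2 * (x ^ 2 * t) := by ring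
    _ ≤ 48 * H.κ * η + 48 * η + H.m ^ 2 * η := by gcongr
    _ = η * (48 * H.κ + 48 + H.m ^ 2) := by ring
    _ ≤ 2 * H.s ^ 2 := hηs

variable [IsProbabilityMeasure ν] {S : Type*} [MeasurableSpace S] {ρ : Measure S}
  [IsProbabilityMeasure ρ] {π : PricingPolicy S d}

/- The distance at which two parameters cannot be told apart varies with the round, so the two-point
bound is averaged over a grid that is fine enough for all rounds. -/
theorem mul_le_four_mul_sum_roundRegret (hD : 0 < D) (hD1 : D ≤ 1) (hη : 0 < η)
    (hηD : η ≤ D ^ 2 / 4) (hηs : η * (48 * H.κ + 48 + H.m ^ 2) ≤ 2 * H.s ^ 2) {t N : ℕ} (hT : 1 ≤ T)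
    (ht : t ≤ T) (hN : D ≤ N * √(resolution η σS T t))
    (hreg : ∀ τ ∈ Set.Icc 1 (1 + D), (H.market ν σS τ).regret ρ π T ≤ ENNReal.ofReal √T) :
    N * ENNReal.ofReal (H.m ^ 2 / (4096 * H.κ) * resolution η σS T t) ≤
      4 * ∑ j ∈ Finset.range N, (H.market ν σS (1 + D * j / N)).roundRegret ρ π t := by
  have hκ := H.κ_pos
  have hpos := resolution_pos (σ := σS) (t := t) hη hT
  have hle : √(resolution η σS T t) ≤ D / 2 := by
    refine Real.sqrt_le_iff.2 ⟨by positivity, (resolution_le hη hT).trans ?_⟩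
    linarith
  obtain ⟨n, hnN, hn_ge, hn_le⟩ := exists_shift_mem_Icc hD (Real.sqrt_pos.2 hpos) hle hN
  have hδ_ge : resolution η σS T t / 4 ≤ (D * n / N) ^ 2 := by
    have := pow_le_pow_left₀ (by positivity) hn_ge 2
    rw [div_pow, Real.sq_sqrt hpos.le] at this
    linarith
  have hδ_le : (D * n / N) ^ 2 ≤ resolution η σS T t := by
    have := pow_le_pow_left₀ (by positivity) hn_le 2
    rwa [Real.sq_sqrt hpos.le] at this
  refine mul_le_four_mul_sum_of_le_add_shift _ hnN fun j hj => ?_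
  have hτ := one_add_mul_div_mem_Icc hD.le (Nat.le_of_add_right_le hj.le)
  have hτ' := one_add_mul_div_mem_Icc hD.le hj.le
  have hdiff : 1 + D * (j + n : ℕ) / N - (1 + D * j / N) = D * n / N := by
    push_cast
    ring
  have hregt (τ : ℝ) (hτ : τ ∈ Set.Icc 1 (1 + D)) :
      (H.market ν σS τ).regret ρ π t ≤ ENNReal.ofReal √T :=
    (Market.regret_mono _ ρ π ht).trans (hreg τ hτ)
  have hIcc : Set.Icc 1 (1 + D) ⊆ Set.Icc 1 2 := Set.Icc_subset_Icc_right (by linarith)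
  have htwo := H.le_roundRegret_market_add (hIcc hτ) (hIcc hτ') (Real.sqrt_nonneg _)
    (hregt _ hτ) (hregt _ hτ') (by
      rw [hdiff]
      exact H.close_of_sq_le_resolution hη (by nlinarith) hηs hT ht hδ_le)
  refine (ENNReal.ofReal_le_ofReal ?_).trans htwo
  rw [hdiff]
  calc H.m ^ 2 / (4096 * H.κ) * resolution η σS T t
    _ = H.m ^ 2 * (resolution η σS T t / 4) / (1024 * H.κ) := by ring
    _ ≤ H.m ^ 2 * (D * n / N) ^ 2 / (1024 * H.κ) := by gcongr

theorem mul_log_le_four_mul_sum_regret (hσS : 0 < σS) (hD : 0 < D) (hD1 : D ≤ 1) (hη : 0 < η)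
    (hηD : η ≤ D ^ 2 / 4) (hηs : η * (48 * H.κ + 48 + H.m ^ 2) ≤ 2 * H.s ^ 2) {N : ℕ} (hT : 1 ≤ T)
    (hN : D ≤ N * √(resolution η σS T T))
    (hreg : ∀ τ ∈ Set.Icc 1 (1 + D), (H.market ν σS τ).regret ρ π T ≤ ENNReal.ofReal √T) :
    N * ENNReal.ofReal
        (H.m ^ 2 / (4096 * H.κ) * (η * (Real.log (1 + σS ^ 2 * √T) / σS ^ 2))) ≤
      4 * ∑ j ∈ Finset.range N, (H.market ν σS (1 + D * j / N)).regret ρ π T := by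
  have hκ := H.κ_pos
  have hround (t : ℕ) (ht : t ∈ Finset.range T) :
      N * ENNReal.ofReal (H.m ^ 2 / (4096 * H.κ) * resolution η σS T t) ≤
        4 * ∑ j ∈ Finset.range N, (H.market ν σS (1 + D * j / N)).roundRegret ρ π t := by
    have htT := (Finset.mem_range.1 ht).le
    refine H.mul_le_four_mul_sum_roundRegret hD hD1 hη hηD hηs hT htT (hN.trans ?_) hreg
    gcongr
    exact resolution_le_resolution hη hT htT
  calc N * ENNReal.ofReal
          (H.m ^ 2 / (4096 * H.κ) * (η * (Real.log (1 + σS ^ 2 * √T) / σS ^ 2)))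
    _ ≤ N * ENNReal.ofReal
          (∑ t ∈ Finset.range T, H.m ^ 2 / (4096 * H.κ) * resolution η σS T t) := by
      rw [← Finset.mul_sum]
      gcongr
      exact mul_log_div_le_sum_resolution hη hσS hT
    _ = ∑ t ∈ Finset.range T,
          N * ENNReal.ofReal (H.m ^ 2 / (4096 * H.κ) * resolution η σS T t) := by
      rw [ENNReal.ofReal_sum_of_nonneg
        (fun t _ => mul_nonneg (by positivity) (resolution_pos hη hT).le), Finset.mul_sum]
    _ ≤ ∑ t ∈ Finset.range T,
          4 * ∑ j ∈ Finset.range N, (H.market ν σS (1 + D * j / N)).roundRegret ρ π t :=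
      Finset.sum_le_sum hround
    _ = _ := by
      simp only [Market.regret]
      rw [← Finset.mul_sum, Finset.sum_comm]

theorem exists_log_le_regret_of_regret_le_sqrt (hσS : 0 < σS) (hD : 0 < D) (hD1 : D ≤ 1)
    (hη : 0 < η) (hηD : η ≤ D ^ 2 / 4) (hηs : η * (48 * H.κ + 48 + H.m ^ 2) ≤ 2 * H.s ^ 2)
    (hT : 1 ≤ T)
    (hreg : ∀ τ ∈ Set.Icc 1 (1 + D), (H.market ν σS τ).regret ρ π T ≤ ENNReal.ofReal √T) :
    ∃ τ ∈ Set.Icc 1 (1 + D), ENNReal.ofReal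
        (H.m ^ 2 * η / (16384 * H.κ) * (Real.log (1 + σS ^ 2 * √T) / σS ^ 2)) ≤
      (H.market ν σS τ).regret ρ π T := by
  have hsqrt := Real.sqrt_pos.2 (resolution_pos (σ := σS) (t := T) hη hT)
  obtain ⟨N, hN⟩ := exists_nat_ge (D / √(resolution η σS T T))
  have hNpos : 0 < N := by exact_mod_cast (div_pos hD hsqrt).trans_le hN
  rw [div_le_iff₀ hsqrt] at hN
  have hsum := H.mul_log_le_four_mul_sum_regret hσS hD hD1 hη hηD hηs hT hN hreg
  rw [← nsmul_eq_mul, ← Finset.card_range N, ← Finset.sum_const, Finset.mul_sum,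
    Finset.card_range] at hsum
  obtain ⟨j, hj, hle⟩ := ENNReal.exists_le_of_sum_le ⟨0, Finset.mem_range.2 hNpos⟩ hsum
  refine ⟨_, one_add_mul_div_mem_Icc hD.le (Finset.mem_range.1 hj).le, ?_⟩
  refine le_of_eq_of_le ?_ (ENNReal.div_le_of_le_mul' hle)
  rw [← ENNReal.ofReal_ofNat 4, ← ENNReal.ofReal_div_of_pos four_pos]
  ring_nf

end HardFamily

theorem min_sqrt_log_le {σ : ℝ} (hσ : 0 < σ) {T : ℕ} (hT : 1 ≤ T) :
    min √T (Real.log T / (σ ^ 2 * (1 + max 0 (Real.log (1 / σ))))) ≤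
      8 * (Real.log (1 + σ ^ 2 * √T) / σ ^ 2) := by
  have hX : 0 < √(T : ℝ) := Real.sqrt_pos.2 (by exact_mod_cast hT)
  have hlogT : Real.log T = 2 * Real.log √T := by
    rw [Real.log_sqrt T.cast_nonneg]
    ring
  set X := √(T : ℝ)
  set l := max 0 (Real.log (1 / σ))
  have hl : 0 ≤ l := le_max_left _ _
  rcases le_total (σ ^ 2 * X) 1 with hsmall | hlarge
  · refine (min_le_left _ _).trans ?_
    rw [← mul_div_assoc, le_div_iff₀' (by positivity)]
    have hlog := Real.le_log_one_add_of_nonneg (x := σ ^ 2 * X) (by positivity)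
    rw [div_le_iff₀ (by positivity)] at hlog
    nlinarith [mul_pos (pow_pos hσ 2) hX]
  · refine (min_le_right _ _).trans ?_
    rw [mul_comm (σ ^ 2), ← div_div, ← mul_div_assoc, hlogT]
    gcongr
    rw [div_le_iff₀ (by positivity)]
    have hlog_half : 1 / 2 ≤ Real.log (1 + σ ^ 2 * X) :=
      (by linarith [Real.log_two_gt_d9] : (1 : ℝ) / 2 ≤ Real.log 2).trans
        (Real.log_le_log two_pos (by linarith))
    have hlogσ : -Real.log σ ≤ l := by
      rw [← Real.log_inv, ← one_div]
      exact le_max_right _ _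
    have hlogX : Real.log X - 2 * l ≤ Real.log (1 + σ ^ 2 * X) := by
      have hmono : Real.log (σ ^ 2 * X) ≤ Real.log (1 + σ ^ 2 * X) :=
        Real.log_le_log (by positivity) (by linarith)
      rw [Real.log_mul (by positivity) hX.ne', Real.log_pow] at hmono
      push_cast at hmono
      linarith
    nlinarith

namespace HardFamily

theorem exists_min_sqrt_log_le_regret (H : HardFamily) {D : ℝ} (hD : 0 < D) (hD1 : D ≤ 1) :
    ∃ c : ℝ, 0 < c ∧ ∀ (T : ℕ), 1 ≤ T → ∀ (σS : ℝ), 0 < σS →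
      ∀ (d : ℕ) (ν : Measure (Fin d → ℝ)) [IsProbabilityMeasure ν]
        (S : Type*) [MeasurableSpace S] (ρ : Measure S) [IsProbabilityMeasure ρ]
        (π : PricingPolicy S d),
      ∃ τ ∈ Set.Icc 1 (1 + D),
        ENNReal.ofReal (c * min √T (Real.log T / (σS ^ 2 * (1 + max 0 (Real.log (1 / σS)))))) ≤
          (H.market ν σS τ).regret ρ π T := by
  have hκ := H.κ_pos
  have hm := H.m_pos
  have hs := H.s_pos
  set η := min (D ^ 2 / 4) (2 * H.s ^ 2 / (48 * H.κ + 48 + H.m ^ 2))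
  have hη : 0 < η := by positivity
  have hηs : η * (48 * H.κ + 48 + H.m ^ 2) ≤ 2 * H.s ^ 2 := by
    rw [← le_div_iff₀ (by positivity)]
    exact min_le_right _ _
  set C := H.m ^ 2 * η / (16384 * H.κ)
  refine ⟨min 1 (C / 8), by positivity, fun T hT σS hσS d ν _ S _ ρ _ π => ?_⟩
  have hmin := min_sqrt_log_le hσS hT
  set B := min √(T : ℝ) (Real.log T / (σS ^ 2 * (1 + max 0 (Real.log (1 / σS)))))
  have hB : 0 ≤ B := le_min (Real.sqrt_nonneg _)
    (div_nonneg (Real.log_nonneg (by exact_mod_cast hT)) (by positivity))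
  by_cases hreg : ∀ τ ∈ Set.Icc 1 (1 + D),
      (H.market ν σS τ).regret ρ π T ≤ ENNReal.ofReal √T
  · obtain ⟨τ, hτ, hlog⟩ := H.exists_log_le_regret_of_regret_le_sqrt hσS hD hD1 hη
      (min_le_left _ _) hηs hT hreg
    refine ⟨τ, hτ, (ENNReal.ofReal_le_ofReal ?_).trans hlog⟩
    calc min 1 (C / 8) * B ≤ C / 8 * B := by gcongr; exact min_le_right _ _
      _ ≤ C / 8 * (8 * (Real.log (1 + σS ^ 2 * √T) / σS ^ 2)) := by gcongr
      _ = C * (Real.log (1 + σS ^ 2 * √T) / σS ^ 2) := by ring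
  · push Not at hreg
    obtain ⟨τ, hτ, hsqrt⟩ := hreg
    refine ⟨τ, hτ, (ENNReal.ofReal_le_ofReal ?_).trans hsqrt.le⟩
    exact (mul_le_of_le_one_left hB (min_le_left _ _)).trans (min_le_left _ _)

theorem exists_market_parameters_mem_Icc (H : HardFamily) {bLo βHi sLo : ℝ}
    (hb : bLo < H.α₀ + H.m) (hβ : H.α₁ - H.κ < βHi) (hs : sLo < H.s) :
    ∃ D : ℝ, 0 < D ∧ D ≤ 1 ∧ ∀ τ ∈ Set.Icc 1 (1 + D),
      H.α₀ + H.m / τ ∈ Set.Icc bLo (H.α₀ + H.m) ∧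
        H.α₁ - H.κ / τ ^ 2 ∈ Set.Icc (H.α₁ - H.κ) βHi ∧ H.s / τ ^ 2 ∈ Set.Icc sLo H.s := by
  have hcont : ContinuousAt (fun τ : ℝ => H.α₀ + H.m / τ) 1 := by fun_prop (disch := norm_num)
  have hcont' : ContinuousAt (fun τ : ℝ => H.α₁ - H.κ / τ ^ 2) 1 := by
    fun_prop (disch := norm_num)
  have hcont'' : ContinuousAt (fun τ : ℝ => H.s / τ ^ 2) 1 := by fun_prop (disch := norm_num)
  have hnhds := (hcont.eventually (lt_mem_nhds (a := bLo) (by simpa using hb))).and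
    ((hcont'.eventually (gt_mem_nhds (show _ < βHi by simpa using hβ))).and
      (hcont''.eventually (lt_mem_nhds (a := sLo) (by simpa using hs))))
  obtain ⟨ε, hε, hball⟩ := Metric.eventually_nhds_iff.1 hnhds
  refine ⟨min 1 (ε / 2), by positivity, min_le_left _ _, fun τ hτ => ?_⟩
  have hdist : dist τ 1 < ε := by
    rw [Real.dist_eq, abs_of_nonneg (sub_nonneg.2 hτ.1)]
    linarith [min_le_right 1 (ε / 2), hτ.2]
  obtain ⟨hbLo, hβHi, hsLo⟩ := hball hdist
  have hτ2 : 1 ≤ τ ^ 2 := one_le_pow₀ hτ.1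
  refine ⟨⟨hbLo.le, ?_⟩, ⟨?_, hβHi.le⟩, hsLo.le, div_le_self H.s_pos.le hτ2⟩
  · gcongr
    exact div_le_self H.m_pos.le hτ.1
  · gcongr
    exact div_le_self H.κ_pos.le hτ2

end HardFamily

theorem theorem5_general
    {α₀ α₁ bLo bHi βLo βHi sLo sHi : ℝ} (hb : bLo < bHi) (hbα : α₀ < bHi)
    (hβ : βLo < βHi) (hβα : βLo < α₁) (hs : sLo < sHi) (hs0 : 0 < sHi) :
    ∃ c : ℝ, 0 < c ∧ ∀ (T : ℕ), 1 ≤ T → ∀ (σS : ℝ), 0 < σS →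
      ∀ (d : ℕ) (ν : Measure (Fin d → ℝ)) [IsProbabilityMeasure ν]
        (S : Type*) [MeasurableSpace S] (ρ : Measure S) [IsProbabilityMeasure ρ]
        (π : PricingPolicy S d),
      ∃ b ∈ Set.Icc bLo bHi, ∃ β ∈ Set.Icc βLo βHi, ∃ σD ∈ Set.Icc sLo sHi,
        ENNReal.ofReal (c * min √T (Real.log T / (σS ^ 2 * (1 + max 0 (Real.log (1 / σS)))))) ≤
          Market.regret
            { α₀ := α₀, α₁ := α₁, β := β, f := fun _ => b, ν := ν, σS := σS, σD := σD } ρ π T := by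
  let H : HardFamily :=
    { α₀ := α₀, α₁ := α₁, κ := α₁ - βLo, m := bHi - α₀, s := sHi
      κ_pos := sub_pos.2 hβα, m_pos := sub_pos.2 hbα, s_pos := hs0 }
  have hbHi : H.α₀ + H.m = bHi := add_sub_cancel α₀ bHi
  have hβLo : H.α₁ - H.κ = βLo := sub_sub_cancel α₁ βLo
  obtain ⟨D, hD, hD1, hmem⟩ := H.exists_market_parameters_mem_Icc (bLo := bLo) (βHi := βHi)
    (sLo := sLo) (hbHi ▸ hb) (hβLo ▸ hβ) hs
  rw [hbHi, hβLo] at hmem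
  obtain ⟨c, hc, hregret⟩ := H.exists_min_sqrt_log_le_regret hD hD1
  refine ⟨c, hc, fun T hT σS hσS d ν _ S _ ρ _ π => ?_⟩
  obtain ⟨τ, hτ, hle⟩ := hregret T hT σS hσS d ν S ρ π
  obtain ⟨hbτ, hβτ, hsτ⟩ := hmem τ hτ
  exact ⟨_, hbτ, _, hβτ, _, hsτ, hle⟩

theorem theorem5
    (α₀ α₁ : ℝ) (hα₁ : 0 ≤ α₁)
    (bLo bHi : ℝ) (hb : bLo < bHi) (hbα : α₀ < bHi)
    (βLo βHi : ℝ) (hβ : βLo < βHi) (hβ0 : βHi < 0)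
    (sLo sHi : ℝ) (hs0 : 0 < sLo) (hs : sLo < sHi) :
    ∃ c : ℝ, 0 < c ∧
      ∀ (T : ℕ), 1 ≤ T → ∀ (σS : ℝ), 0 < σS →
      ∀ (d : ℕ) (ν : Measure (Fin d → ℝ)) [IsProbabilityMeasure ν]
        (F : Set ((Fin d → ℝ) → ℝ)), (∀ b ∈ Set.Icc bLo bHi, (fun _ => b) ∈ F) →
      ∀ (S : Type*) [MeasurableSpace S] (ρ : Measure S) [IsProbabilityMeasure ρ]
        (π : PricingPolicy S d),
      ∃ f ∈ F, ∃ β ∈ Set.Icc βLo βHi, ∃ σD ∈ Set.Icc sLo sHi,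
        ENNReal.ofReal (c * min (Real.sqrt T)
            (Real.log T / (σS ^ 2 * (1 + max 0 (Real.log (1 / σS))))))
          ≤ Market.regret
              { α₀ := α₀, α₁ := α₁, β := β, f := f, ν := ν, σS := σS, σD := σD } ρ π T := by
  obtain ⟨c, hc, hregret⟩ := theorem5_general hb hbα hβ (hβ.trans (hβ0.trans_le hα₁)) hs
    (hs0.trans hs)
  refine ⟨c, hc, fun T hT σS hσS d ν _ F hF S _ ρ _ π => ?_⟩
  obtain ⟨b, hb, h⟩ := hregret T hT σS hσS d ν S ρ π
  exact ⟨_, hF b hb, h⟩
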